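/- Let $G=(V,E)$ be an infinite (simple) graph. Two rays of $G$ are equivalent if, for every finite $S\subseteq V$, both have a tail in the same component of $G-S$; the ends of $G$ are the equivalence classes of rays. A separation of $G$ is a pair $(A,B)$ of sets with $A\cup B=V$ such that $G$ has no edge between $A\setminus B$ and $B\setminus A$; its order is $|A\cap B|$. Let $\vec S$ be the set of all separations of finite order, with the topology whose basic open sets are the sets $\{(A,B)\in\vec S : A\cap Z=A_Z,\ B\cap Z=B_Z\}$ for finite $Z\subseteq V$ and separations $(A_Z,B_Z)$ of $G[Z]$. For $k\in\mathbb N$ let $\vec S_k$ be the set of separations of order less than $k$. Let $\omega$ be an end of $G$, let $\tau=\{(A,B)\in\vec S : \text{every ray of }\omega\text{ has a tail in }B\}$ be its end tangle, and let $k\in\mathbb N$. Let $\deg(\omega)\in\mathbb N\cup\{\infty\}$ be the largest size of a family of pairwise disjoint rays of $\omega$, and let $\operatorname{dom}(\omega)\in\mathbb N\cup\{\infty\}$ be the number of vertices $v$ that dominate $\omega$, i.e. for which there are a ray $R$ of $\omega$ and infinitely many paths from $v$ to vertices of $R$ that are pairwise disjoint except at $v$. Call $X\subseteq V$ a relative decider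 for $\tau\cap\vec S_k$ if $|A\cap X|<|B\cap X|$ for every $(A,B)\in\tau\cap\vec S_k$. Then the following are equivalent: (i) $\tau\cap\vec S_k$ is closed in $\vec S$; (ii) $\deg(\omega)+\operatorname{dom}(\omega)\ge k$; (iii) $\tau\cap\vec S_k$ has a finite relative decider; (iv) $\tau\cap\vec S_k$ has a relative decider of size exactly $k$. -/

import Mathlib

namespace EndTangle

variable {V : Type*}

/-! ### Rays and ends -/

/-- A ray of `G`: a one-way infinite path, listed from its start vertex. -/
structure Ray (G : SimpleGraph V) where
  vertex : ℕ → V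
  injective : Function.Injective vertex
  adj : ∀ n, G.Adj (vertex n) (vertex (n + 1))

/-- The vertex set of a ray. -/
def Ray.verts {G : SimpleGraph V} (R : Ray G) : Set V := Set.range R.vertex

/-- The ray `R` has a tail in the vertex set `B`. -/
def Ray.HasTailIn {G : SimpleGraph V} (R : Ray G) (B : Set V) : Prop :=
  ∃ n, ∀ m, n ≤ m → R.vertex m ∈ B

/-- Two rays are equivalent if, for every finite vertex set `S`, both have a tail in the same
component of `G - S`. -/
def Ray.Equivalent {G : SimpleGraph V} (R R' : Ray G) : Prop :=
  ∀ S : Set V, S.Finite →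
    ∃ C : G.ComponentCompl S, R.HasTailIn (C : Set V) ∧ R'.HasTailIn (C : Set V)

theorem Ray.exists_component {G : SimpleGraph V} (R : Ray G) {S : Set V} (hS : S.Finite) :
    ∃ C : G.ComponentCompl S, R.HasTailIn (C : Set V) := by
  have hfin : (R.vertex ⁻¹' S).Finite := hS.preimage R.injective.injOn
  obtain ⟨N, hN⟩ := hfin.bddAbove
  have hout : ∀ m, N + 1 ≤ m → R.vertex m ∉ S := by
    intro m hm hmem
    have := hN (show m ∈ R.vertex ⁻¹' S from hmem)
    omega
  refine ⟨G.componentComplMk (hout (N + 1) le_rfl), N + 1, ?_⟩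
  intro m hm
  induction m, hm using Nat.le_induction with
  | base => exact ⟨hout _ le_rfl, rfl⟩
  | succ m hm ih =>
    obtain ⟨h, hC⟩ := ih
    refine ⟨hout (m + 1) (by omega), ?_⟩
    rw [← hC]
    exact SimpleGraph.ConnectedComponent.sound
      (SimpleGraph.Adj.reachable (show (G.induce Sᶜ).Adj ⟨_, _⟩ ⟨_, _⟩ from (R.adj m).symm))

theorem Ray.component_unique {G : SimpleGraph V} (R : Ray G) {S : Set V}
    {C D : G.ComponentCompl S} (hC : R.HasTailIn (C : Set V)) (hD : R.HasTailIn (D : Set V)) :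
    C = D := by
  obtain ⟨n, hn⟩ := hC
  obtain ⟨m, hm⟩ := hD
  obtain ⟨_, h₁⟩ := hn (max n m) (le_max_left _ _)
  obtain ⟨_, h₂⟩ := hm (max n m) (le_max_right _ _)
  exact h₁.symm.trans h₂

/-- Equivalence of rays, as a setoid. -/
def raySetoid (G : SimpleGraph V) : Setoid (Ray G) where
  r := Ray.Equivalent
  iseqv :=
    { refl := fun R _ hS => (R.exists_component hS).imp fun _ h => ⟨h, h⟩
      symm := fun h S hS => (h S hS).imp fun _ hC => hC.symm
      trans := by
        intro R₁ R₂ R₃ h h' S hS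
        obtain ⟨C, hC₁, hC₂⟩ := h S hS
        obtain ⟨D, hD₂, hD₃⟩ := h' S hS
        obtain rfl := R₂.component_unique hC₂ hD₂
        exact ⟨C, hC₁, hD₃⟩ }

/-- An end of `G` is an equivalence class of rays. -/
def GraphEnd (G : SimpleGraph V) : Type _ := Quotient (raySetoid G)

/-- The set of `ω`-rays, i.e. the rays that belong to the end `ω`. -/
def GraphEnd.rays {G : SimpleGraph V} (ω : GraphEnd G) : Set (Ray G) :=
  {R | Quotient.mk (raySetoid G) R = ω}

/-- The (vertex) degree of an end: the largest size of a set of pairwise disjoint `ω`-rays. -/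
noncomputable def GraphEnd.degree {G : SimpleGraph V} (ω : GraphEnd G) : ℕ∞ :=
  ⨆ F ∈ {F : Set (Ray G) | F ⊆ ω.rays ∧ F.Pairwise fun R R' => Disjoint R.verts R'.verts},
    F.encard

/-- The vertex `v` sends infinitely many paths to the ray `R` that are pairwise disjoint except
at their common start vertex `v`. The paths are collected in an infinite set (not a family), so
the trivial path counts at most once if `v` lies on `R`. -/
def DominatesRay {G : SimpleGraph V} (v : V) (R : Ray G) : Prop :=
  ∃ F : Set (Σ w : V, G.Path v w), F.Infinite ∧ (∀ P ∈ F, P.1 ∈ R.verts) ∧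
    F.Pairwise fun P Q => ∀ u, u ∈ P.2.1.support → u ∈ Q.2.1.support → u = v

/-- The vertex `v` dominates the end `ω`. -/
def GraphEnd.IsDominatedBy {G : SimpleGraph V} (ω : GraphEnd G) (v : V) : Prop :=
  ∃ R ∈ ω.rays, DominatesRay v R

/-- The number of vertices that dominate `ω`. -/
noncomputable def GraphEnd.dom {G : SimpleGraph V} (ω : GraphEnd G) : ℕ∞ :=
  {v : V | ω.IsDominatedBy v}.encard

/-! ### Separations and their topology -/

/-- An oriented separation `(A, B)` of `G`. -/
@[ext]
structure Separation (G : SimpleGraph V) where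
  A : Set V
  B : Set V
  union_eq : A ∪ B = Set.univ
  not_adj : ∀ a ∈ A \ B, ∀ b ∈ B \ A, ¬ G.Adj a b

/-- The separation `(A ∩ Z, B ∩ Z)` of `G[Z]` induced by `(A, B)` on `Z`. -/
def Separation.restrict {G : SimpleGraph V} (s : Separation G) (Z : Set V) :
    Separation (G.induce Z) where
  A := {z | (z : V) ∈ s.A}
  B := {z | (z : V) ∈ s.B}
  union_eq := by
    ext z
    have h : (z : V) ∈ s.A ∪ s.B := s.union_eq ▸ Set.mem_univ _
    simpa using h
  not_adj := fun a ha b hb h => s.not_adj a ha b hb h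

/-- The order `|A ∩ B|` of a separation. -/
noncomputable def Separation.order {G : SimpleGraph V} (s : Separation G) : ℕ∞ :=
  (s.A ∩ s.B).encard

/-- The set of all oriented separations of `G` of finite order. -/
def FinSep (G : SimpleGraph V) : Type _ := {s : Separation G // (s.A ∩ s.B).Finite}

/-- The basic open set of all separations of finite order that induce the separation `t` of
`G[Z]` on `Z`. -/
def basicOpen {G : SimpleGraph V} {Z : Set V} (t : Separation (G.induce Z)) : Set (FinSep G) :=
  {s | s.1.restrict Z = t}

/-- The topology on the separations of finite order given by the basic open sets for finite `Z`. -/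
instance finSepTopology (G : SimpleGraph V) : TopologicalSpace (FinSep G) :=
  TopologicalSpace.generateFrom
    {O | ∃ Z : Set V, Z.Finite ∧ ∃ t : Separation (G.induce Z), O = basicOpen t}

/-- The set of all oriented separations of `G` of order less than `k`. -/
def sepsBelow (G : SimpleGraph V) (k : ℕ) : Set (FinSep G) := {s | s.1.order < k}

/-! ### End tangles and relative deciders -/

/-- The end tangle induced by `ω`: all separations `(A, B)` of finite order such that every ray of
`ω` has a tail in `B`. -/
def GraphEnd.tangle {G : SimpleGraph V} (ω : GraphEnd G) : Set (FinSep G) :=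
  {s | ∀ R ∈ ω.rays, R.HasTailIn s.1.B}

/-- `X` is a relative decider for `τ`: a strict majority of `X` lies in `B`, in the sense that
`|A ∩ X| < |B ∩ X|` as cardinals, for every `(A, B) ∈ τ`. -/
def IsRelativeDecider {G : SimpleGraph V} (X : Set V) (τ : Set (FinSep G)) : Prop :=
  ∀ s ∈ τ, Cardinal.mk ↥(s.1.A ∩ X) < Cardinal.mk ↥(s.1.B ∩ X)

end EndTangle

/-!
Call a set `W` a hub for a family of disjoint rays of `ω` and vertices dominating `ω` if it is
connected, meets each of these rays and contains a neighbour of each of these vertices. If the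
family has `k` members, then the separator of a separation in the end tangle of order less than `k`
cannot contain one vertex for every member, so it meets every hub that is not contained in the big
side `B`. Hence, if `x` is the only common vertex of two hubs, every such separation with `x`
strictly on its small side has two separator vertices in their union, the guard of `x`. Choose
vertices with pairwise disjoint guards, one for every ray of the family, that also avoid its
dominating vertices, and let `X` consist of the chosen and of the dominating vertices. A separator
of fewer than `k = |X|` vertices contains two of them for every vertex of `X` strictly on the small
side and one for every vertex of `X` in the separator itself, so the small side has the minority
of `X`.

A finite relative decider `X` makes `τ ∩ S_k` closed, since exactly one of `(A, B)` and `(B, A)`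
lies in `τ`, and a separation and its neighbours have the same traces on `X`.

Conversely, suppose that only finitely many vertices dominate `ω`. A separation in `τ` that has all
of these on its side `A`, and that is smallest in order among all larger separations in `τ`, is
linked by disjoint paths to every larger separation in `τ`, by Menger's theorem. Along a chain of
such separations these paths compose to disjoint rays of `ω`, one for every vertex of the first
separator that does not dominate `ω`. So the first order is at most `deg ω + dom ω`. If that is less
than `k`, then `(V, D)`, where `D` is the set of all dominating vertices, is a limit of `τ ∩ S_k`;
but `(V, D)` is not in `τ`.
-/

namespace EndTangle

variable {V : Type*} {G : SimpleGraph V}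

/-! ### Walks inside a vertex set -/

/-- `x` and `y` are joined by a walk of `G` with all vertices in `U`. This is reachability in
`G.induce U`, stated for vertices of `G` so that `U` can vary. -/
def Joined (G : SimpleGraph V) (U : Set V) (x y : V) : Prop :=
  ∃ p : G.Walk x y, ∀ v ∈ p.support, v ∈ U

namespace Joined

variable {U W P : Set V} {x y z : V}

theorem refl (hx : x ∈ U) : Joined G U x x :=
  ⟨.nil, by simpa using hx⟩

theorem cons (hx : x ∈ U) (hxy : G.Adj x y) : Joined G U y z → Joined G U x z
  | ⟨p, hp⟩ => ⟨p.cons hxy, by simpa [hx] using hp⟩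

theorem left_mem : Joined G U x y → x ∈ U
  | ⟨p, hp⟩ => hp _ p.start_mem_support

theorem right_mem : Joined G U x y → y ∈ U
  | ⟨p, hp⟩ => hp _ p.end_mem_support

theorem symm : Joined G U x y → Joined G U y x
  | ⟨p, hp⟩ => ⟨p.reverse, by simpa using hp⟩

theorem mono (hUW : U ⊆ W) : Joined G U x y → Joined G W x y
  | ⟨p, hp⟩ => ⟨p, fun v hv => hUW (hp v hv)⟩

theorem concat (hxy : Joined G U x y) (hyz : G.Adj y z) (hz : z ∈ U) : Joined G U x z :=
  (cons hz hyz.symm hxy.symm).symm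

theorem mem_of_closed (hxy : Joined G U x y) (hx : x ∈ P)
    (hP : ∀ u ∈ P, ∀ v ∈ U, G.Adj u v → v ∈ P) : y ∈ P := by
  obtain ⟨p, hp⟩ := hxy
  induction p with
  | nil => exact hx
  | cons hadj p ih =>
    simp only [SimpleGraph.Walk.support_cons, List.mem_cons, forall_eq_or_imp] at hp
    exact ih (hP _ hx _ (hp.2 _ p.start_mem_support) hadj) hp.2

theorem exists_path : Joined G U x y → ∃ p : G.Path x y, ∀ v ∈ p.1.support, v ∈ U
  | ⟨p, hp⟩ => by
    classical
    exact ⟨p.toPath, fun v hv => hp v (p.support_toPath_subset_support hv)⟩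

theorem exists_finset : Joined G U x y → ∃ F : Finset V, ↑F ⊆ U ∧ Joined G F x y
  | ⟨p, hp⟩ => by
    classical
    exact ⟨p.support.toFinset, fun v hv => hp v (by simpa using hv), p, by simp⟩

end Joined

theorem joined_coe_iff {U : Set V} {x y : U} : Joined G U x y ↔ (G.induce U).Reachable x y := by
  refine ⟨fun ⟨p, hp⟩ => ⟨p.induce U hp⟩, fun ⟨p⟩ => ?_⟩
  induction p with
  | nil => exact .refl (Subtype.prop _)
  | cons h p ih => exact .cons (Subtype.prop _) h (ih ⟨p⟩)

theorem preconnected_induce_iff_joined {U : Set V} :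
    (G.induce U).Preconnected ↔ ∀ x ∈ U, ∀ y ∈ U, Joined G U x y :=
  ⟨fun h x hx y hy => joined_coe_iff.2 (h ⟨x, hx⟩ ⟨y, hy⟩),
    fun h x y => joined_coe_iff.1 (h x x.2 y y.2)⟩

theorem exists_finset_preconnected_induce {M : Set V} (hM : (G.induce M).Preconnected)
    {F : Finset V} (hFM : ↑F ⊆ M) :
    ∃ W : Finset V, F ⊆ W ∧ ↑W ⊆ M ∧ (G.induce (W : Set V)).Preconnected := by
  classical
  obtain rfl | ⟨v, hv⟩ := F.eq_empty_or_nonempty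
  · exact ⟨∅, subset_rfl, hFM, fun x => absurd x.2 (Finset.notMem_empty _)⟩
  obtain ⟨W, hFW, hW⟩ := SimpleGraph.extend_finset_to_connected hM
    (t := F.subtype (· ∈ M)) ⟨⟨v, hFM hv⟩, by simpa using hv⟩
  refine ⟨W.map (.subtype (· ∈ M)), fun u hu => ?_, fun u => by simp +contextual, ?_⟩
  · exact Finset.mem_map.2 ⟨⟨u, hFM hu⟩, hFW (Finset.mem_subtype.2 hu), rfl⟩
  let f : (G.induce M).induce (W : Set M) →g
      G.induce (W.map (.subtype (· ∈ M)) : Finset V) :=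
    ⟨fun x => ⟨x.1, Finset.mem_map_of_mem _ x.2⟩, id⟩
  have hf : Function.Surjective f := by
    rintro ⟨_, hx⟩
    obtain ⟨x, hxW, rfl⟩ := Finset.mem_map.1 hx
    exact ⟨⟨x, hxW⟩, rfl⟩
  exact hW.preconnected.map f hf

theorem mem_componentCompl_of_joined {S : Set V} {C : G.ComponentCompl S} {x y : V}
    (hx : x ∈ C) (hxy : Joined G Sᶜ x y) : y ∈ C :=
  hxy.mem_of_closed (P := C) hx fun u hu v hv huv =>
    SimpleGraph.ComponentCompl.mem_of_adj u v hu hv huv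

theorem preconnected_induce_componentCompl {S : Set V} (C : G.ComponentCompl S) :
    (G.induce (C : Set V)).Preconnected := by
  refine preconnected_induce_iff_joined.2 fun x hx y hy => ?_
  have hxy : Joined G Sᶜ x y := by
    obtain ⟨hxS, rfl⟩ := hx
    obtain ⟨hyS, hyx⟩ := hy
    exact joined_coe_iff (x := ⟨x, hxS⟩) (y := ⟨y, hyS⟩).2
      (SimpleGraph.ConnectedComponent.exact hyx.symm)
  exact hxy.mem_of_closed (P := {z | Joined G C x z}) (.refl hx) fun u hu v hv huv =>
    hu.concat huv (SimpleGraph.ComponentCompl.mem_of_adj u v hu.right_mem hv huv)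

/-! ### Rays, ends and separations -/

namespace Ray

variable {R : Ray G} {U W : Set V}

theorem HasTailIn.mono (h : R.HasTailIn U) (hUW : U ⊆ W) : R.HasTailIn W :=
  h.imp fun _ hn m hm => hUW (hn m hm)

theorem HasTailIn.exists_ge_mem (h : R.HasTailIn U) (n : ℕ) : ∃ m ≥ n, R.vertex m ∈ U :=
  let ⟨m, hm⟩ := h
  ⟨max n m, le_max_left _ _, hm _ (le_max_right _ _)⟩

theorem HasTailIn.exists_mem (h : R.HasTailIn U) : ∃ v ∈ R.verts, v ∈ U :=
  let ⟨n, _, hn⟩ := h.exists_ge_mem 0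
  ⟨R.vertex n, ⟨n, rfl⟩, hn⟩

theorem HasTailIn.inter (hU : R.HasTailIn U) (hW : R.HasTailIn W) : R.HasTailIn (U ∩ W) := by
  obtain ⟨n, hn⟩ := hU
  obtain ⟨m, hm⟩ := hW
  exact ⟨max n m, fun i hi => ⟨hn i (le_of_max_le_left hi), hm i (le_of_max_le_right hi)⟩⟩

theorem hasTailIn_compl (R : Ray G) (hU : U.Finite) : R.HasTailIn Uᶜ :=
  let ⟨C, hC⟩ := R.exists_component hU
  hC.mono C.disjoint_right.subset_compl_left

theorem joined_segment (R : Ray G) {n m : ℕ} (hnm : n ≤ m) :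
    Joined G (R.vertex '' Set.Icc n m) (R.vertex n) (R.vertex m) := by
  induction m, hnm using Nat.le_induction with
  | base => exact .refl ⟨n, Set.left_mem_Icc.2 le_rfl, rfl⟩
  | succ m hm ih =>
    refine .concat (ih.mono (Set.image_mono (Set.Icc_subset_Icc_right m.le_succ))) (R.adj m) ?_
    exact ⟨m + 1, Set.right_mem_Icc.2 (hm.trans m.le_succ), rfl⟩

/-- The tail of `R` starting at its vertex with index `n`. -/
def drop (R : Ray G) (n : ℕ) : Ray G where
  vertex i := R.vertex (n + i)
  injective := R.injective.comp (add_right_injective n)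
  adj i := R.adj (n + i)

theorem hasTailIn_drop {n : ℕ} : (R.drop n).HasTailIn U ↔ R.HasTailIn U := by
  constructor
  · rintro ⟨m, hm⟩
    refine ⟨n + m, fun i hi => ?_⟩
    obtain ⟨j, rfl⟩ := Nat.exists_eq_add_of_le hi
    rw [Nat.add_assoc]
    exact hm (m + j) (m.le_add_right j)
  · rintro ⟨m, hm⟩
    exact ⟨m, fun i hi => hm (n + i) (by omega)⟩

end Ray

namespace GraphEnd

variable {ω : GraphEnd G} {S : Set V} {R : Ray G}

theorem exists_mem_rays (ω : GraphEnd G) : ∃ R, R ∈ ω.rays :=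
  Quotient.exists_rep ω

theorem exists_component (ω : GraphEnd G) (hS : S.Finite) :
    ∃ C : G.ComponentCompl S, ∀ R ∈ ω.rays, R.HasTailIn C := by
  obtain ⟨R, hR⟩ := ω.exists_mem_rays
  obtain ⟨C, hC⟩ := R.exists_component hS
  refine ⟨C, fun R' hR' => ?_⟩
  obtain ⟨D, hD, hD'⟩ := Quotient.exact (s := raySetoid G) (hR.trans hR'.symm) S hS
  rwa [R.component_unique hC hD]

/-- The component of `G - S` in which the end `ω` lives. -/
noncomputable def component (ω : GraphEnd G) (hS : S.Finite) : G.ComponentCompl S :=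
  (ω.exists_component hS).choose

theorem hasTailIn_component (hR : R ∈ ω.rays) (hS : S.Finite) : R.HasTailIn (ω.component hS) :=
  (ω.exists_component hS).choose_spec R hR

theorem mem_rays_iff :
    R ∈ ω.rays ↔ ∀ (S : Set V) (hS : S.Finite), R.HasTailIn (ω.component hS) := by
  refine ⟨fun hR S => hasTailIn_component hR, fun h => ?_⟩
  obtain ⟨R', hR'⟩ := ω.exists_mem_rays
  have equivalent : R.Equivalent R' := fun S hS =>
    ⟨ω.component hS, h S hS, hasTailIn_component hR' hS⟩
  exact (Quotient.sound (s := raySetoid G) equivalent).trans hR'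

theorem drop_mem_rays {n : ℕ} : R.drop n ∈ ω.rays ↔ R ∈ ω.rays := by
  simp only [mem_rays_iff, Ray.hasTailIn_drop]

end GraphEnd

namespace Separation

variable {s : Separation G}

/-- The separation `(B, A)`. -/
def swap (s : Separation G) : Separation G where
  A := s.B
  B := s.A
  union_eq := by rw [Set.union_comm, s.union_eq]
  not_adj a ha b hb h := s.not_adj b hb a ha h.symm

theorem swap_order (s : Separation G) : s.swap.order = s.order :=
  congrArg Set.encard (Set.inter_comm _ _)

theorem mem_or (s : Separation G) (v : V) : v ∈ s.A ∨ v ∈ s.B :=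
  (s.union_eq ▸ Set.mem_univ v : v ∈ s.A ∪ s.B)

theorem mem_A_of_adj {u v : V} (hu : u ∉ s.B) (huv : G.Adj u v) : v ∈ s.A := by
  by_contra hv
  exact s.not_adj u ⟨(s.mem_or u).resolve_right hu, hu⟩ v ⟨(s.mem_or v).resolve_left hv, hv⟩ huv

theorem exists_mem_inter_of_joined {U : Set V} {x y : V} (hxy : Joined G U x y) (hx : x ∈ s.A)
    (hy : y ∈ s.B) : ∃ a ∈ s.A ∩ s.B, Joined G (U ∩ s.A) x a := by
  obtain ⟨p, hp⟩ := hxy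
  induction p with
  | nil => exact ⟨_, ⟨hx, hy⟩, .refl ⟨hp _ (by simp), hx⟩⟩
  | @cons u v w huv p ih =>
    simp only [SimpleGraph.Walk.support_cons, List.mem_cons, forall_eq_or_imp] at hp
    by_cases hu : u ∈ s.B
    · exact ⟨u, ⟨hx, hu⟩, .refl ⟨hp.1, hx⟩⟩
    · obtain ⟨a, ha, hva⟩ := ih (s.mem_A_of_adj hu huv) hy hp.2
      exact ⟨a, ha, .cons ⟨hp.1, hx⟩ huv hva⟩

theorem inter_nonempty_of_preconnected {M : Set V} (hM : (G.induce M).Preconnected)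
    (hA : (M ∩ s.A).Nonempty) (hB : (M ∩ s.B).Nonempty) : (M ∩ (s.A ∩ s.B)).Nonempty := by
  obtain ⟨x, hx, hxA⟩ := hA
  obtain ⟨y, hy, hyB⟩ := hB
  obtain ⟨a, ha, hxa⟩ :=
    exists_mem_inter_of_joined (preconnected_induce_iff_joined.1 hM x hx y hy) hxA hyB
  exact ⟨a, hxa.right_mem.1, ha⟩

theorem subset_diff_of_preconnected {M : Set V} (hM : (G.induce M).Preconnected)
    (hdisj : Disjoint M (s.A ∩ s.B)) : M ⊆ s.A \ s.B ∨ M ⊆ s.B \ s.A := by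
  by_contra! h
  obtain ⟨⟨x, hx, hxAB⟩, y, hy, hyBA⟩ := h.imp Set.not_subset.1 Set.not_subset.1
  have hxB : x ∈ s.B := (s.mem_or x).elim (fun hA => by_contra fun hB => hxAB ⟨hA, hB⟩) id
  have hyA : y ∈ s.A := (s.mem_or y).elim id fun hB => by_contra fun hA => hyBA ⟨hB, hA⟩
  exact (inter_nonempty_of_preconnected hM ⟨y, hy, hyA⟩ ⟨x, hx, hxB⟩).not_disjoint hdisj

/-- The order of separations from small to big: `s ≤ t` if `t` points further towards its `B`. -/
instance : SemilatticeSup (Separation G) where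
  le s t := s.A ⊆ t.A ∧ t.B ⊆ s.B
  le_refl s := ⟨subset_rfl, subset_rfl⟩
  le_trans s t u hst htu := ⟨hst.1.trans htu.1, htu.2.trans hst.2⟩
  le_antisymm s t hst hts := Separation.ext (hst.1.antisymm hts.1) (hts.2.antisymm hst.2)
  sup s t :=
    { A := s.A ∪ t.A
      B := s.B ∩ t.B
      union_eq := by
        ext v
        have := s.mem_or v
        have := t.mem_or v
        simp only [Set.mem_union, Set.mem_inter_iff, Set.mem_univ, iff_true]
        tauto
      not_adj := by
        rintro a ⟨-, ha⟩ b ⟨-, hb⟩ hab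
        rw [Set.mem_union, not_or] at hb
        exact ha ⟨by_contra fun h => hb.1 (s.mem_A_of_adj h hab),
          by_contra fun h => hb.2 (t.mem_A_of_adj h hab)⟩ }
  le_sup_left _ _ := ⟨Set.subset_union_left, Set.inter_subset_left⟩
  le_sup_right _ _ := ⟨Set.subset_union_right, Set.inter_subset_right⟩
  sup_le _ _ _ hsu htu := ⟨Set.union_subset hsu.1 htu.1, Set.subset_inter hsu.2 htu.2⟩

end Separation

namespace FinSep

/-- The separation `(B, A)`. -/
def swap (s : FinSep G) : FinSep G :=
  ⟨s.1.swap, by simpa only [Separation.swap, Set.inter_comm] using s.2⟩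

instance : SemilatticeSup (FinSep G) :=
  Subtype.semilatticeSup fun _ _ hs ht => (hs.union ht).subset fun _ ⟨hvA, hvB⟩ =>
    hvA.imp (fun h => ⟨h, hvB.1⟩) fun h => ⟨h, hvB.2⟩

end FinSep

/-! ### End tangles and dominating vertices -/

namespace GraphEnd

variable {ω : GraphEnd G} {s t : FinSep G} {R : Ray G}

theorem mem_tangle_iff : s ∈ ω.tangle ↔ (ω.component s.2 : Set V) ⊆ s.1.B \ s.1.A := by
  refine ⟨fun hs => ?_, fun h R hR =>
    (hasTailIn_component hR s.2).mono (h.trans Set.sdiff_subset)⟩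
  refine (Separation.subset_diff_of_preconnected (preconnected_induce_componentCompl _)
    (ω.component s.2).disjoint_right.symm).resolve_left fun hA => ?_
  obtain ⟨R, hR⟩ := ω.exists_mem_rays
  obtain ⟨v, -, hvB, hv⟩ := ((hs R hR).inter (hasTailIn_component hR s.2)).exists_mem
  exact (hA hv).2 hvB

theorem hasTailIn_diff (hs : s ∈ ω.tangle) (hR : R ∈ ω.rays) : R.HasTailIn (s.1.B \ s.1.A) :=
  (hasTailIn_component hR s.2).mono (mem_tangle_iff.1 hs)

theorem swap_mem_tangle (hs : s ∉ ω.tangle) : s.swap ∈ ω.tangle := fun _ hR =>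
  (hasTailIn_component hR s.2).mono <|
    ((Separation.subset_diff_of_preconnected (preconnected_induce_componentCompl _)
      (ω.component s.2).disjoint_right.symm).resolve_right (mt mem_tangle_iff.2 hs)).trans
      Set.sdiff_subset

theorem sup_mem_tangle (hs : s ∈ ω.tangle) (ht : t ∈ ω.tangle) : s ⊔ t ∈ ω.tangle :=
  fun R hR => (hs R hR).inter (ht R hR)

/-- The separation with separator `X` that cuts off exactly the component of `G - X` in which `ω`
lives. -/
noncomputable def sepAt (ω : GraphEnd G) {X : Set V} (hX : X.Finite) : FinSep G :=
  ⟨{ A := (ω.component hX)ᶜ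
     B := ω.component hX ∪ X
     union_eq := by rw [← Set.union_assoc, Set.compl_union_self, Set.univ_union]
     not_adj := by
       rintro a ⟨ha, haB⟩ b ⟨-, hb⟩ hab
       exact ha (SimpleGraph.ComponentCompl.mem_of_adj b a (not_not.1 hb)
         (fun haX => haB (Or.inr haX)) hab.symm) },
   hX.subset fun _ ⟨hA, hB⟩ => hB.resolve_left hA⟩

section sepAt

variable {X : Set V} (hX : X.Finite)

theorem sepAt_inter : (ω.sepAt hX).1.A ∩ (ω.sepAt hX).1.B = X := by
  have : Disjoint X (ω.component hX) := (ω.component hX).disjoint_right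
  rw [sepAt, Set.inter_union_distrib_left, Set.compl_inter_self, Set.empty_union,
    Set.inter_eq_right]
  exact this.subset_compl_right

theorem sepAt_diff : (ω.sepAt hX).1.B \ (ω.sepAt hX).1.A = ω.component hX := by
  ext v
  simp +contextual [sepAt]

theorem sepAt_mem_tangle : ω.sepAt hX ∈ ω.tangle := fun _ hR =>
  (hasTailIn_component hR hX).mono Set.subset_union_left

theorem le_sepAt (hs : s ∈ ω.tangle) : s ≤ ω.sepAt s.2 := by
  have hC := mem_tangle_iff.1 hs
  exact ⟨fun v hvA hvC => (hC hvC).2 hvA,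
    Set.union_subset (hC.trans Set.sdiff_subset) Set.inter_subset_right⟩

end sepAt

end GraphEnd

namespace DominatesRay

variable {R : Ray G} {v : V}

theorem exists_joined {F : Set V} (h : DominatesRay v R)
    (hF : F.Finite) (hv : v ∉ F) : ∃ w ∈ R.verts, w ≠ v ∧ Joined G Fᶜ v w := by
  obtain ⟨Q, hQ, hQR, hdisj⟩ := h
  by_contra! hno
  have meets_F : ∀ P ∈ Q \ {⟨v, .nil⟩}, ∃ u ∈ P.2.1.support, u ∈ F := by
    rintro ⟨w, p⟩ ⟨hp, hnil⟩
    by_contra! havoid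
    refine hno w (hQR _ hp) ?_ ⟨p.1, havoid⟩
    rintro rfl
    exact hnil (by rw [SimpleGraph.Path.loop_eq p]; rfl)
  have : Nonempty V := ⟨v⟩
  choose! u hu huF using meets_F
  obtain ⟨P, hP, P', hP', hne, heq⟩ :=
    (hQ.sdiff (Set.finite_singleton _)).exists_ne_map_eq_of_mapsTo huF hF
  have huv : u P = v := hdisj hP.1 hP'.1 hne _ (hu P hP) (heq ▸ hu P' hP')
  exact hv (huv ▸ huF P hP)

theorem of_forall_exists_joined
    (h : ∀ F : Set V, F.Finite → v ∉ F → ∃ w ∈ R.verts, w ≠ v ∧ Joined G Fᶜ v w) :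
    DominatesRay v R := by
  classical
  let MeetOnlyAt (P Q : Σ w, G.Path v w) : Prop :=
    ∀ u ∈ P.2.1.support, u ∈ Q.2.1.support → u = v
  have : Std.Symm MeetOnlyAt := ⟨fun P Q hPQ u hu hu' => hPQ u hu' hu⟩
  obtain ⟨f, hf, hdisj⟩ := exists_seq_of_forall_finset_exists'
    (fun P : Σ w, G.Path v w => P.1 ∈ R.verts ∧ P.1 ≠ v) MeetOnlyAt fun T _ => by
      obtain ⟨w, hw, hwv, hvw⟩ :=
        h ((T.biUnion fun P => P.2.1.support.toFinset).erase v : Finset V)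
          (Finset.finite_toSet _) (by simp)
      obtain ⟨p, hp⟩ := hvw.exists_path
      refine ⟨⟨w, p⟩, ⟨hw, hwv⟩, fun P hP u hu hu' => by_contra fun huv => hp u hu' ?_⟩
      exact Finset.mem_erase.2 ⟨huv, Finset.mem_biUnion.2 ⟨P, hP, List.mem_toFinset.2 hu⟩⟩
  have hinj : Function.Injective f := fun m n hmn => by_contra fun hne =>
    (hf m).2 (hdisj hne _ (f m).2.1.end_mem_support (hmn ▸ (f m).2.1.end_mem_support))
  refine ⟨Set.range f, Set.infinite_range_of_injective hinj, ?_, ?_⟩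
  · rintro _ ⟨n, rfl⟩
    exact (hf n).1
  · rintro _ ⟨m, rfl⟩ _ ⟨n, rfl⟩ hne
    exact hdisj (ne_of_apply_ne f hne)

end DominatesRay

namespace GraphEnd

variable {ω : GraphEnd G} {s : FinSep G} {S : Set V} {v : V}

theorem isDominatedBy_iff :
    ω.IsDominatedBy v ↔ ∀ (S : Set V) (hS : S.Finite), v ∉ S → v ∈ ω.component hS := by
  constructor
  · rintro ⟨R, hR, hdom⟩ S hS hv
    obtain ⟨n, hn⟩ := hasTailIn_component hR hS
    obtain ⟨_, ⟨m, rfl⟩, hmv, hjoined⟩ := hdom.exists_joined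
      (F := S ∪ (R.vertex '' Set.Iio n \ {v})) (hS.union (((Set.finite_Iio n).image _).sdiff))
      (by simp [hv])
    have hm : n ≤ m := by
      by_contra! hmn
      exact hjoined.right_mem (Or.inr ⟨⟨m, hmn, rfl⟩, hmv⟩)
    exact mem_componentCompl_of_joined (hn m hm)
      (hjoined.mono (Set.compl_subset_compl.2 Set.subset_union_left)).symm
  · intro h
    obtain ⟨R, hR⟩ := ω.exists_mem_rays
    refine ⟨R, hR, .of_forall_exists_joined fun F hF hv => ?_⟩
    obtain ⟨w, hw, hwC, hwv⟩ := ((hasTailIn_component hR hF).inter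
      (R.hasTailIn_compl (Set.finite_singleton v))).exists_mem
    refine ⟨w, hw, hwv, ?_⟩
    exact (preconnected_induce_iff_joined.1 (preconnected_induce_componentCompl _)
      v (h F hF hv) w hwC).mono (ω.component hF).disjoint_right.subset_compl_left

theorem mem_B_of_isDominatedBy (hv : ω.IsDominatedBy v) (hs : s ∈ ω.tangle) : v ∈ s.1.B := by
  by_cases hv' : v ∈ s.1.A ∩ s.1.B
  · exact hv'.2
  · exact (mem_tangle_iff.1 hs (isDominatedBy_iff.1 hv _ s.2 hv')).1

theorem exists_mem_tangle_notMem_B (hv : ¬ ω.IsDominatedBy v) : ∃ s ∈ ω.tangle, v ∉ s.1.B := by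
  simp only [isDominatedBy_iff, not_forall] at hv
  obtain ⟨S, hS, hvS, hvC⟩ := hv
  exact ⟨ω.sepAt hS, sepAt_mem_tangle hS, fun h => h.elim hvC hvS⟩

theorem exists_adj_mem_component (hv : ω.IsDominatedBy v) (hS : S.Finite) :
    ∃ u ∈ ω.component hS, G.Adj v u := by
  obtain ⟨R, hR⟩ := ω.exists_mem_rays
  have hS' : (S \ {v}).Finite := hS.sdiff
  obtain ⟨w, -, ⟨hwC, hwC'⟩, hwv⟩ := (((hasTailIn_component hR hS).inter
    (hasTailIn_component hR hS')).inter
    (R.hasTailIn_compl (Set.finite_singleton v))).exists_mem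
  have hvC' : v ∈ ω.component hS' := isDominatedBy_iff.1 hv _ hS' (by simp)
  obtain ⟨⟨p, hpath⟩, hp⟩ := (preconnected_induce_iff_joined.1
    (preconnected_induce_componentCompl _) v hvC' w hwC').exists_path
  cases p with
  | nil => exact absurd rfl hwv
  | @cons _ u _ hvu p =>
    rw [SimpleGraph.Walk.cons_isPath_iff] at hpath
    refine ⟨u, mem_componentCompl_of_joined hwC (Joined.symm ⟨p, fun x hx hxS => ?_⟩), hvu⟩
    have hxC' : x ∈ ω.component hS' := hp x (List.mem_cons_of_mem _ hx)
    refine SimpleGraph.ComponentCompl.notMem_of_mem hxC' ⟨hxS, ?_⟩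
    rintro rfl
    exact hpath.2 hx

end GraphEnd

/-! ### The topology on separations -/

theorem Separation.restrict_eq_iff {s t : Separation G} {Z : Set V} :
    s.restrict Z = t.restrict Z ↔ s.A ∩ Z = t.A ∩ Z ∧ s.B ∩ Z = t.B ∩ Z := by
  simp only [Separation.ext_iff, Separation.restrict, Set.ext_iff, Set.mem_ofPred_eq,
    Subtype.forall, Set.mem_inter_iff, and_congr_left_iff]

namespace FinSep

theorem mem_basicOpen_restrict_iff {s t : FinSep G} {Z : Set V} :
    s ∈ basicOpen (t.1.restrict Z) ↔ s.1.A ∩ Z = t.1.A ∩ Z ∧ s.1.B ∩ Z = t.1.B ∩ Z :=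
  Separation.restrict_eq_iff

theorem isTopologicalBasis_basicOpen :
    TopologicalSpace.IsTopologicalBasis
      {O : Set (FinSep G) | ∃ Z : Set V, Z.Finite ∧ ∃ t : Separation (G.induce Z),
        O = basicOpen t} where
  exists_subset_inter := by
    rintro _ ⟨Z, hZ, t, rfl⟩ _ ⟨Z', hZ', t', rfl⟩ p ⟨rfl, rfl⟩
    refine ⟨basicOpen (p.1.restrict (Z ∪ Z')), ⟨_, hZ.union hZ', _, rfl⟩, rfl, fun s hs => ?_⟩
    obtain ⟨hA, hB⟩ := mem_basicOpen_restrict_iff.1 hs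
    have agree {Y} (hY : Y ⊆ Z ∪ Z') : s ∈ basicOpen (p.1.restrict Y) := by
      rw [mem_basicOpen_restrict_iff, ← Set.inter_eq_right.2 hY]
      simp only [← Set.inter_assoc, hA, hB, and_self]
    exact ⟨agree Set.subset_union_left, agree Set.subset_union_right⟩
  sUnion_eq := Set.sUnion_eq_univ_iff.2 fun p =>
    ⟨basicOpen (p.1.restrict ∅), ⟨∅, Set.finite_empty, _, rfl⟩, rfl⟩
  eq_generateFrom := rfl

theorem nhds_hasBasis (p : FinSep G) :
    (nhds p).HasBasis Set.Finite fun Z : Set V => basicOpen (p.1.restrict Z) := by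
  refine ⟨fun O => isTopologicalBasis_basicOpen.mem_nhds_iff.trans ⟨?_, ?_⟩⟩
  · rintro ⟨_, ⟨Z, hZ, _, rfl⟩, rfl, hO⟩
    exact ⟨Z, hZ, hO⟩
  · rintro ⟨Z, hZ, hO⟩
    exact ⟨_, ⟨Z, hZ, _, rfl⟩, rfl, hO⟩

end FinSep

theorem GraphEnd.isClosed_of_isRelativeDecider (ω : GraphEnd G) {k : ℕ} {X : Set V}
    (hX : X.Finite) (hdec : IsRelativeDecider X (ω.tangle ∩ sepsBelow G k)) :
    IsClosed (ω.tangle ∩ sepsBelow G k) := by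
  rw [← isOpen_compl_iff, isOpen_iff_mem_nhds]
  refine fun p hp => p.nhds_hasBasis.mem_iff.2 ?_
  by_cases hk : p.1.order < k
  · have hswap : p.swap ∈ ω.tangle ∩ sepsBelow G k :=
      ⟨swap_mem_tangle fun hτ => hp ⟨hτ, hk⟩, p.1.swap_order.trans_lt hk⟩
    refine ⟨X, hX, fun s hs hsτ => ?_⟩
    obtain ⟨hA, hB⟩ := FinSep.mem_basicOpen_restrict_iff.1 hs
    have hlt := hdec s hsτ
    rw [hA, hB] at hlt
    exact hlt.asymm (hdec p.swap hswap)
  · refine ⟨p.1.A ∩ p.1.B, p.2, fun s hs hsτ => hk (lt_of_le_of_lt ?_ hsτ.2)⟩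
    obtain ⟨hA, hB⟩ := FinSep.mem_basicOpen_restrict_iff.1 hs
    refine Set.encard_le_encard (Set.subset_inter ?_ ?_)
    · exact Set.inter_eq_right.1 (hA.trans (Set.inter_eq_right.2 Set.inter_subset_left))
    · exact Set.inter_eq_right.1 (hB.trans (Set.inter_eq_right.2 Set.inter_subset_right))

/-! ### Deciders from rays and dominating vertices -/

theorem Ray.inter_nonempty_of_mem_A {R : Ray G} {s : Separation G} (hB : R.HasTailIn s.B)
    (hA : (R.verts ∩ s.A).Nonempty) : (R.verts ∩ (s.A ∩ s.B)).Nonempty := by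
  obtain ⟨_, ⟨n, rfl⟩, hn⟩ := hA
  obtain ⟨m, hnm, hm⟩ := hB.exists_ge_mem n
  obtain ⟨v, hv, hnv⟩ := s.exists_mem_inter_of_joined (R.joined_segment hnm) hn hm
  exact ⟨v, Set.image_subset_range _ _ hnv.right_mem.1, hv⟩

/-- Pairwise disjoint `ω`-rays `ρ i` together with a set `D` of vertices that dominate `ω` and lie
on none of these rays. The supremum of `ENat.card ι + D.encard` over all such families is
`ω.degree + ω.dom`. -/
structure IsCombinedFamily {ι : Type*} (ω : GraphEnd G) (ρ : ι → Ray G) (D : Set V) : Prop where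
  mem_rays : ∀ i, ρ i ∈ ω.rays
  pairwise_disjoint : Pairwise fun i j => Disjoint (ρ i).verts (ρ j).verts
  isDominatedBy : ∀ d ∈ D, ω.IsDominatedBy d
  disjoint : ∀ i, Disjoint (ρ i).verts D

/-- A connected vertex set `W` that meets every ray `ρ i` and contains a neighbour of every vertex
in `D`. A separation of small order cannot have all of `W` strictly on the side away from `ω`, as
its separator would then have to meet every `ρ i` and to contain `D`. -/
structure IsHub {ι : Type*} (ρ : ι → Ray G) (D W : Set V) : Prop where
  preconnected : (G.induce W).Preconnected
  inter_verts_nonempty : ∀ i, (W ∩ (ρ i).verts).Nonempty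
  exists_adj : ∀ d ∈ D, ∃ u ∈ W, G.Adj d u

theorem GraphEnd.vertex_mem_component {ω : GraphEnd G} {R : Ray G} (hR : R ∈ ω.rays) {S : Set V}
    (hS : S.Finite) {n : ℕ} (hn : ∀ m, n ≤ m → R.vertex m ∉ S) :
    R.vertex n ∈ ω.component hS := by
  obtain ⟨m, hnm, hm⟩ := (hasTailIn_component hR hS).exists_ge_mem n
  refine mem_componentCompl_of_joined hm ((R.joined_segment hnm).mono ?_).symm
  exact Set.image_subset_iff.2 fun i hi => hn i hi.1

section Hub

variable {ι : Type*} {ω : GraphEnd G} {ρ : ι → Ray G} {D : Set V}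

theorem IsCombinedFamily.exists_isHub [Finite ι] (hρ : IsCombinedFamily ω ρ D) (hD : D.Finite)
    {F : Set V} (hF : F.Finite) {x : V} (hx : x ∈ ω.component hF) :
    ∃ W : Finset V, x ∈ W ∧ ↑W ⊆ (ω.component hF : Set V) ∧ IsHub ρ D W := by
  choose r hr hrF using fun i => (GraphEnd.hasTailIn_component (hρ.mem_rays i) hF).exists_mem
  choose! u huF hu using fun d hd => GraphEnd.exists_adj_mem_component (hρ.isDominatedBy d hd) hF
  have hK : (insert x (Set.range r ∪ u '' D)).Finite :=
    ((Set.finite_range r).union (hD.image u)).insert x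
  have hKF : insert x (Set.range r ∪ u '' D) ⊆ ω.component hF := Set.insert_subset hx
    (Set.union_subset (Set.range_subset_iff.2 hrF) (Set.image_subset_iff.2 huF))
  lift insert x (Set.range r ∪ u '' D) to Finset V using hK with K hKeq
  obtain ⟨W, hKW, hWF, hW⟩ :=
    exists_finset_preconnected_induce (preconnected_induce_componentCompl _) hKF
  replace hKW : insert x (Set.range r ∪ u '' D) ⊆ W := hKeq ▸ Finset.coe_subset.2 hKW
  refine ⟨W, hKW (Or.inl rfl), hWF, hW, fun i => ⟨r i, hKW (Or.inr (Or.inl ⟨i, rfl⟩)), hr i⟩,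
    fun d hd => ⟨u d, hKW (Or.inr (Or.inr ⟨d, hd, rfl⟩)), hu d hd⟩⟩

theorem IsCombinedFamily.card_add_encard_le_order (hρ : IsCombinedFamily ω ρ D) {s : FinSep G}
    (hs : s ∈ ω.tangle) (hρA : ∀ i, ((ρ i).verts ∩ s.1.A).Nonempty) (hDA : D ⊆ s.1.A) :
    ENat.card ι + D.encard ≤ s.1.order := by
  choose f hf hfs using fun i => Ray.inter_nonempty_of_mem_A (hs _ (hρ.mem_rays i)) (hρA i)
  have hinj : Function.Injective f := fun i j hij => by_contra fun hne =>
    Set.disjoint_left.1 (hρ.pairwise_disjoint hne) (hf i) (hij ▸ hf j)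
  have hdisj : Disjoint (Set.range f) D := by
    rw [Set.disjoint_left]
    rintro _ ⟨i, rfl⟩
    exact Set.disjoint_left.1 (hρ.disjoint i) (hf i)
  refine (add_le_add_left hinj.encard_range _).trans ?_
  rw [← Set.encard_union_eq hdisj]
  exact Set.encard_le_encard (Set.union_subset (Set.range_subset_iff.2 hfs)
    fun d hd => ⟨hDA hd, GraphEnd.mem_B_of_isDominatedBy (hρ.isDominatedBy d hd) hs⟩)

theorem IsHub.inter_nonempty {W : Set V} (hub : IsHub ρ D W) (hρ : IsCombinedFamily ω ρ D)
    {s : FinSep G} (hs : s ∈ ω.tangle) (hk : s.1.order < ENat.card ι + D.encard) {x : V}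
    (hxW : x ∈ W) (hxB : x ∉ s.1.B) : (W ∩ (s.1.A ∩ s.1.B)).Nonempty := by
  by_contra hempty
  have hW : W ⊆ s.1.A \ s.1.B :=
    (s.1.subset_diff_of_preconnected hub.preconnected
      (Set.disjoint_iff_inter_eq_empty.2 (Set.not_nonempty_iff_eq_empty.1 hempty))).resolve_right
        fun h => hxB (h hxW).1
  refine hk.not_ge (hρ.card_add_encard_le_order hs (fun i => ?_) fun d hd => ?_)
  · obtain ⟨v, hvW, hv⟩ := hub.inter_verts_nonempty i
    exact ⟨v, hv, (hW hvW).1⟩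
  · obtain ⟨u, huW, hdu⟩ := hub.exists_adj d hd
    exact s.1.mem_A_of_adj (hW huW).2 hdu.symm

end Hub

/-- `Y` contains `x` as well as two separator vertices of every separation of order less than `k`
in the end tangle that has `x` strictly on its small side. -/
structure IsGuard (ω : GraphEnd G) (k : ℕ) (x : V) (Y : Set V) : Prop where
  mem : x ∈ Y
  nontrivial : ∀ s ∈ ω.tangle ∩ sepsBelow G k, x ∉ s.1.B → (Y ∩ (s.1.A ∩ s.1.B)).Nontrivial

section Guard

variable {ω : GraphEnd G}

theorem isGuard_singleton {x : V} (hx : ω.IsDominatedBy x) (k : ℕ) : IsGuard ω k x {x} :=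
  ⟨rfl, fun _ hs hxB => absurd (GraphEnd.mem_B_of_isDominatedBy hx hs.1) hxB⟩

theorem isGuard_union {ι : Type*} {ρ : ι → Ray G} {D W₁ W₂ : Set V} {x : V} {k : ℕ}
    (hρ : IsCombinedFamily ω ρ D) (hk : ENat.card ι + D.encard = k) (hub₁ : IsHub ρ D W₁)
    (hub₂ : IsHub ρ D W₂) (hx : W₁ ∩ W₂ = {x}) : IsGuard ω k x (W₁ ∪ W₂) := by
  have hx' : x ∈ W₁ ∩ W₂ := hx ▸ rfl
  refine ⟨Or.inl hx'.1, fun s ⟨hs, hsk⟩ hxB => ?_⟩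
  have hsk' : s.1.order < ENat.card ι + D.encard := hk ▸ hsk
  obtain ⟨u, hu, hus⟩ := hub₁.inter_nonempty hρ hs hsk' hx'.1 hxB
  obtain ⟨v, hv, hvs⟩ := hub₂.inter_nonempty hρ hs hsk' hx'.2 hxB
  refine ⟨u, ⟨Or.inl hu, hus⟩, v, ⟨Or.inr hv, hvs⟩, ?_⟩
  rintro rfl
  have hux : u = x := hx.subset ⟨hu, hv⟩
  exact hxB (hux ▸ hus.2)

theorem IsCombinedFamily.exists_isGuard {ι : Type*} {ρ : ι → Ray G} {D : Set V}
    (hρ : IsCombinedFamily ω ρ D) {k : ℕ} (hk : ENat.card ι + D.encard = k) (F : Finset V) :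
    ∃ (x : V) (Y : Finset V), IsGuard ω k x Y ∧ Disjoint Y F := by
  classical
  have : Finite ι :=
    ENat.card_lt_top.1 ((le_self_add.trans hk.le).trans_lt (ENat.natCast_lt_top k))
  have hD : D.Finite := Set.finite_of_encard_le_coe (le_add_self.trans hk.le)
  obtain ⟨R, hR⟩ := ω.exists_mem_rays
  have hF := F.finite_toSet
  obtain ⟨a, ha⟩ := GraphEnd.hasTailIn_component hR hF
  obtain ⟨W₁, haW₁, hW₁F, hub₁⟩ := hρ.exists_isHub hD hF (ha a le_rfl)
  -- The last vertex of `R` in the first hub still lives with `ω` when the rest of this hub is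
  -- deleted, so it also lies in a second hub that is otherwise disjoint from the first.
  obtain ⟨b, hbW₁, hbmax⟩ : ∃ b, R.vertex b ∈ W₁ ∧ ∀ m, R.vertex m ∈ W₁ → m ≤ b :=
    Set.exists_max_image _ id (W₁.finite_toSet.preimage R.injective.injOn) ⟨a, haW₁⟩
  have hFW₁ : (F ∪ (W₁ \ {R.vertex b}) : Set V).Finite := hF.union W₁.finite_toSet.sdiff
  obtain ⟨W₂, hbW₂, hW₂F, hub₂⟩ := hρ.exists_isHub hD hFW₁ (x := R.vertex b) <|
    GraphEnd.vertex_mem_component hR hFW₁ fun m hbm => by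
      rintro (hmF | ⟨hmW₁, hm⟩)
      · exact (ω.component hF).disjoint_right.le_bot ⟨hmF, ha m ((hbmax a haW₁).trans hbm)⟩
      · exact hm (congrArg R.vertex ((hbmax m hmW₁).antisymm hbm))
  have hW₂ : Disjoint (F ∪ (W₁ \ {R.vertex b}) : Set V) W₂ :=
    (ω.component hFW₁).disjoint_right.mono_right hW₂F
  rw [Set.disjoint_union_left] at hW₂
  have hinter : (W₁ ∩ W₂ : Set V) = {R.vertex b} := by
    refine Set.Subset.antisymm (fun v ⟨hv₁, hv₂⟩ => by_contra fun hv => ?_) ?_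
    · exact Set.disjoint_left.1 hW₂.2 ⟨hv₁, hv⟩ hv₂
    · exact Set.singleton_subset_iff.2 ⟨hbW₁, hbW₂⟩
  refine ⟨R.vertex b, W₁ ∪ W₂, ?_, Finset.disjoint_union_left.2 ⟨?_, ?_⟩⟩
  · simpa only [Finset.coe_union] using isGuard_union hρ hk hub₁ hub₂ hinter
  · exact Finset.disjoint_coe.1 ((ω.component hF).disjoint_right.mono_right hW₁F).symm
  · exact Finset.disjoint_coe.1 hW₂.1.symm

open scoped Classical in
theorem IsGuard.indicator_add_one_le {k : ℕ} {x : V} {Y : Finset V} (hY : IsGuard ω k x Y)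
    {s : FinSep G} (hs : s ∈ ω.tangle ∩ sepsBelow G k) :
    (if x ∈ s.1.A then 1 else 0) + 1 ≤
      (Y ∩ s.2.toFinset).card + if x ∈ s.1.B then 1 else 0 := by
  by_cases hB : x ∈ s.1.B
  · by_cases hA : x ∈ s.1.A
    · have : 0 < (Y ∩ s.2.toFinset).card :=
        Finset.card_pos.2 ⟨x, Finset.mem_inter.2 ⟨hY.mem, s.2.mem_toFinset.2 ⟨hA, hB⟩⟩⟩
      simp only [hA, hB, if_true]
      omega
    · simp [hA, hB]
  · have : 1 < (Y ∩ s.2.toFinset).card := by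
      rw [Finset.one_lt_card_iff_nontrivial, Finset.Nontrivial, Finset.coe_inter,
        Set.Finite.coe_toFinset]
      exact hY.nontrivial s hs hB
    simp only [hB, if_false]
    split_ifs <;> omega

end Guard

open scoped Classical in
theorem mk_inter_range {κ : Type*} [Fintype κ] {x : κ → V} (hx : x.Injective) (U : Set V) :
    Cardinal.mk ↥(U ∩ Set.range x) = (∑ i, if x i ∈ U then 1 else 0 : ℕ) := by
  have : U ∩ Set.range x = ((Finset.univ.filter (x · ∈ U)).image x : Finset V) := by
    rw [Finset.coe_image, Finset.coe_filter, ← Set.image_preimage_eq_inter_range]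
    simp only [Finset.mem_univ, true_and, Set.preimage]
  rw [this, Finset.coe_sort_coe, Cardinal.mk_coe_finset, Finset.card_image_of_injective _ hx,
    Finset.card_filter]

section Decider

variable {ω : GraphEnd G}

theorem isRelativeDecider_range_of_isGuard {κ : Type*} [Fintype κ] {x : κ → V} {Y : κ → Finset V}
    (hY : Pairwise fun i j => Disjoint (Y i) (Y j)) (hx : x.Injective)
    (hguard : ∀ i, IsGuard ω (Fintype.card κ) (x i) (Y i)) :
    IsRelativeDecider (Set.range x) (ω.tangle ∩ sepsBelow G (Fintype.card κ)) := by
  classical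
  intro s hs
  rw [mk_inter_range hx, mk_inter_range hx, Nat.cast_lt]
  have hcard : s.2.toFinset.card < Fintype.card κ := by
    have : s.1.order < Fintype.card κ := hs.2
    rwa [Separation.order, s.2.encard_eq_coe_toFinset_card, Nat.cast_lt] at this
  have hsum : ∑ i, (Y i ∩ s.2.toFinset).card ≤ s.2.toFinset.card := by
    rw [← Finset.card_biUnion fun i _ j _ hij =>
      (hY hij).mono Finset.inter_subset_left Finset.inter_subset_left]
    exact Finset.card_le_card (Finset.biUnion_subset.2 fun i _ => Finset.inter_subset_right)
  have htotal := Finset.sum_le_sum fun i (_ : i ∈ Finset.univ) =>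
    (hguard i).indicator_add_one_le hs
  rw [Finset.sum_add_distrib, Finset.sum_add_distrib, Finset.sum_const, Finset.card_univ,
    smul_eq_mul, mul_one] at htotal
  omega

theorem IsCombinedFamily.exists_seq_isGuard {ι : Type*} {ρ : ι → Ray G} {D : Finset V}
    (hρ : IsCombinedFamily ω ρ D) {k : ℕ} (hk : ENat.card ι + (D : Set V).encard = k) :
    ∃ (x : ℕ → V) (Y : ℕ → Finset V), (∀ n, IsGuard ω k (x n) (Y n)) ∧
      (∀ n, Disjoint (Y n) D) ∧ Pairwise fun m n => Disjoint (Y m) (Y n) := by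
  classical
  have : Std.Symm fun p q : V × Finset V => Disjoint p.2 q.2 := ⟨fun _ _ h => h.symm⟩
  obtain ⟨f, hf, hdisj⟩ := exists_seq_of_forall_finset_exists'
    (fun p : V × Finset V => IsGuard ω k p.1 p.2 ∧ Disjoint p.2 D)
    (fun p q => Disjoint p.2 q.2) fun T _ => by
      obtain ⟨x, Y, hY, hdisj⟩ := hρ.exists_isGuard hk (T.biUnion Prod.snd ∪ D)
      rw [Finset.disjoint_union_right, Finset.disjoint_biUnion_right] at hdisj
      exact ⟨(x, Y), ⟨hY, hdisj.2⟩, fun p hp => (hdisj.1 p hp).symm⟩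
  exact ⟨fun n => (f n).1, fun n => (f n).2, fun n => (hf n).1, fun n => (hf n).2, hdisj⟩

theorem IsCombinedFamily.exists_isRelativeDecider {ι : Type*} {ρ : ι → Ray G} {D : Set V}
    (hρ : IsCombinedFamily ω ρ D) {k : ℕ} (hk : ENat.card ι + D.encard = k) :
    ∃ X : Set V, X.encard = k ∧ IsRelativeDecider X (ω.tangle ∩ sepsBelow G k) := by
  have : Finite ι :=
    ENat.card_lt_top.1 ((le_self_add.trans hk.le).trans_lt (ENat.natCast_lt_top k))
  have hD : D.Finite := Set.finite_of_encard_le_coe (le_add_self.trans hk.le)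
  lift D to Finset V using hD
  obtain ⟨x, Y, hguard, hYD, hY⟩ := hρ.exists_seq_isGuard hk
  have : Fintype ι := Fintype.ofFinite ι
  let e : ι ↪ ℕ := (Fintype.equivFin ι).toEmbedding.trans Fin.valEmbedding
  let x' : ι ⊕ D → V := Sum.elim (x ∘ e) Subtype.val
  let Y' : ι ⊕ D → Finset V := Sum.elim (Y ∘ e) fun d => {d.1}
  have hguard' : ∀ i, IsGuard ω k (x' i) (Y' i)
    | .inl i => hguard (e i)
    | .inr d => by simpa [x', Y'] using isGuard_singleton (hρ.isDominatedBy d d.2) k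
  have hY' : Pairwise fun i j => Disjoint (Y' i) (Y' j) := by
    rintro (i | d) (j | d') hne
    · exact hY (e.injective.ne (Sum.inl_injective.ne_iff.1 hne))
    · exact (hYD (e i)).mono_right (Finset.singleton_subset_iff.2 d'.2)
    · exact ((hYD (e j)).mono_right (Finset.singleton_subset_iff.2 d.2)).symm
    · exact Finset.disjoint_singleton.2
        (Subtype.val_injective.ne (Sum.inr_injective.ne_iff.1 hne))
  have hx' : x'.Injective := fun i j hij => by_contra fun hne =>
    Finset.disjoint_left.1 (hY' hne) (hguard' i).mem (hij ▸ (hguard' j).mem)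
  obtain rfl : Fintype.card (ι ⊕ D) = k := by
    rw [Fintype.card_sum, Fintype.card_coe]
    exact_mod_cast (by simpa using hk : (Fintype.card ι + D.card : ℕ∞) = k)
  refine ⟨Set.range x', ?_, isRelativeDecider_range_of_isGuard hY' hx' hguard'⟩
  rw [← Set.image_univ, hx'.encard_image, Set.encard_univ, ENat.card_eq_coe_fintype_card]

theorem exists_add_eq_of_natCast_le_add {k : ℕ} {a b : ℕ∞} (hk : (k : ℕ∞) ≤ a + b) :
    ∃ m n : ℕ, m + n = k ∧ (m : ℕ∞) ≤ a ∧ (n : ℕ∞) ≤ b := by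
  obtain hkb | hbk := le_total (k : ℕ∞) b
  · exact ⟨0, k, zero_add k, zero_le, hkb⟩
  · lift b to ℕ using ne_top_of_le_ne_top (ENat.natCast_ne_top k) hbk
    refine ⟨k - b, b, Nat.sub_add_cancel (Nat.cast_le.1 hbk), ?_, le_rfl⟩
    rwa [ENat.natCast_sub, tsub_le_iff_right]

theorem GraphEnd.exists_pairwise_disjoint_of_le_degree (ω : GraphEnd G) {m : ℕ}
    (hm : (m : ℕ∞) ≤ ω.degree) : ∃ ρ : Fin m → Ray G, (∀ i, ρ i ∈ ω.rays) ∧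
      Pairwise fun i j => Disjoint (ρ i).verts (ρ j).verts := by
  cases m with
  | zero => exact ⟨Fin.elim0, fun i => i.elim0, fun i => i.elim0⟩
  | succ m =>
    have hm' : (m : ℕ∞) < ω.degree := lt_of_lt_of_le (Nat.cast_lt.2 m.lt_succ_self) hm
    obtain ⟨F, ⟨hF, hdisj⟩, hmF⟩ := lt_biSup_iff.1 hm'
    obtain ⟨E, hEF, hE⟩ :=
      Set.exists_subset_encard_eq (k := (m + 1 : ℕ)) (Order.add_one_le_of_lt hmF)
    have := (Set.finite_of_encard_eq_coe hE).to_subtype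
    have hcard : Nat.card E = m + 1 := by
      rw [Nat.card_coe_set_eq, Set.ncard, hE, ENat.toNat_natCast]
    let e : Fin (m + 1) ≃ E := (Finite.equivFinOfCardEq hcard).symm
    exact ⟨fun i => e i, fun i => hF (hEF (e i).2), fun i j hij => hdisj (hEF (e i).2)
      (hEF (e j).2) (Subtype.val_injective.ne (e.injective.ne hij))⟩

theorem GraphEnd.exists_isRelativeDecider_of_le (ω : GraphEnd G) {k : ℕ}
    (hk : (k : ℕ∞) ≤ ω.degree + ω.dom) :
    ∃ X : Set V, X.encard = k ∧ IsRelativeDecider X (ω.tangle ∩ sepsBelow G k) := by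
  obtain ⟨m, n, rfl, hm, hn⟩ := exists_add_eq_of_natCast_le_add hk
  obtain ⟨ρ, hρ, hdisj⟩ := ω.exists_pairwise_disjoint_of_le_degree hm
  obtain ⟨D, hD, hDn⟩ := Set.exists_subset_encard_eq hn
  choose N hN using fun i => (ρ i).hasTailIn_compl (Set.finite_of_encard_eq_coe hDn)
  have family : IsCombinedFamily ω (fun i => (ρ i).drop (N i)) D := by
    have hsub (i) : ((ρ i).drop (N i)).verts ⊆ (ρ i).verts :=
      Set.range_subset_iff.2 fun j => ⟨N i + j, rfl⟩
    refine ⟨fun i => drop_mem_rays.2 (hρ i), fun i j hij => (hdisj hij).mono (hsub i) (hsub j),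
      fun d hd => hD hd, fun i => Set.disjoint_left.2 ?_⟩
    rintro _ ⟨j, rfl⟩
    exact hN i _ (Nat.le_add_right _ _)
  exact family.exists_isRelativeDecider (by simp [hDn])

end Decider

/-! ### Linkages and Menger's theorem -/

/-- Every walk from `A` to `B` inside `U` meets `S`. -/
def Separates (G : SimpleGraph V) (U S A B : Set V) : Prop :=
  ∀ a ∈ A, ∀ b ∈ B, ¬ Joined G (U \ S) a b

theorem Separates.anti {U W S A B : Set V} (h : Separates G U S A B) (hWU : W ⊆ U) :
    Separates G W S A B := fun a ha b hb hab =>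
  h a ha b hb (hab.mono (Set.sdiff_subset_sdiff_left hWU))

/-- A system of disjoint paths inside `W` that start in the vertices of `A` and can only end in
`B`. It is encoded by the map `f` that takes every vertex outside `B` to its successor, and fixes
the vertices that lie on none of the paths. With `B = ∅` the paths are rays if `W` is infinite. -/
structure IsLinkage (G : SimpleGraph V) (W A B : Set V) (f : V → V) : Prop where
  mapsTo : Set.MapsTo f (W \ B) (W \ A)
  injOn : Set.InjOn f (W \ B)
  eq_or_adj : ∀ x ∈ W \ B, f x = x ∨ G.Adj x (f x)

/-- Limits of bounded separators along an ultrafilter are separators. -/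
theorem exists_separates_of_forall_finset {U A B : Set V} {n : ℕ}
    (h : ∀ W : Finset V, ∃ S : Finset V, S.card < n ∧ Separates G (W ∩ U) S A B) :
    ∃ S : Finset V, S.card < n ∧ Separates G U S A B := by
  classical
  choose S hSn hS using h
  let 𝒰 : Ultrafilter (Finset V) := .of Filter.atTop
  have eventually_subset (F : Finset V) : ∀ᶠ W in (𝒰 : Filter (Finset V)), F ⊆ W :=
    Ultrafilter.of_le _ (Filter.eventually_ge_atTop F)
  let L : Set V := {v | ∀ᶠ W in (𝒰 : Filter (Finset V)), v ∈ S W}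
  have card_lt_of_subset (T : Finset V) (hT : ↑T ⊆ L) : T.card < n := by
    obtain ⟨W, hW⟩ := ((Filter.eventually_all_finset T).2 hT).exists
    exact (Finset.card_le_card hW).trans_lt (hSn W)
  have hL : L.Finite := by
    by_contra hinf
    obtain ⟨T, hTL, hT⟩ := Set.Infinite.exists_subset_card_eq hinf n
    exact (card_lt_of_subset T hTL).ne hT
  refine ⟨hL.toFinset, card_lt_of_subset _ (by simp), fun a ha b hb hab => ?_⟩
  rw [hL.coe_toFinset] at hab
  obtain ⟨F, hFL, hF⟩ := hab.exists_finset
  have eventually_notMem : ∀ᶠ W in (𝒰 : Filter (Finset V)), ∀ v ∈ F, v ∉ S W :=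
    (Filter.eventually_all_finset F).2 fun v hv => Ultrafilter.eventually_not.2 (hFL hv).2
  obtain ⟨W, hW, hFW⟩ := (eventually_notMem.and (eventually_subset F)).exists
  exact hS W a ha b hb (hF.mono fun v hv => ⟨⟨hFW hv, (hFL hv).1⟩, hW v hv⟩)

/-- The set `N ∪ A` without `T` separates `A` from `B`. -/
theorem card_le_card_of_forall_separates {W A T : Finset V} {B : Set V}
    (hTW : (T : Set V) ⊆ W \ B) (h : ∀ S : Finset V, Separates G W S A B → A.card ≤ S.card)
    {N : Finset V} (hN : ∀ x ∈ T, ∀ y ∈ W, y ∉ A → y = x ∨ G.Adj x y → y ∈ N) :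
    T.card ≤ N.card := by
  classical
  have closed : ∀ x ∈ T, ∀ y ∈ W, y = x ∨ G.Adj x y → y ∈ N ∪ A := fun x hx y hy hxy =>
    Finset.mem_union.2 (or_iff_not_imp_right.2 fun hyA => hN x hx y hy hyA hxy)
  have hsep : Separates G W ((N ∪ A) \ T : Finset V) A B := by
    intro a ha b hb hab
    have mem_T {x : V} (hx : x ∈ N ∪ A) (hx' : x ∉ ((N ∪ A) \ T : Finset V)) : x ∈ T :=
      by_contra fun hxT => hx' (Finset.mem_sdiff.2 ⟨hx, hxT⟩)
    have haT : a ∈ T := mem_T (Finset.mem_union_right _ ha) hab.left_mem.2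
    have hbT : b ∈ T := hab.mem_of_closed (P := T) haT fun u hu v hv huv =>
      mem_T (closed u hu v hv.1 (Or.inr huv)) hv.2
    exact (hTW hbT).2 hb
  have hTN : T ⊆ N ∪ A := fun x hx => closed x hx x (hTW hx).1 (Or.inl rfl)
  have := Finset.card_sdiff_add_card_eq_card hTN
  have := Finset.card_union_le N A
  have := h _ hsep
  omega

/-- Menger's theorem: choose distinct successors by Hall's theorem. -/
theorem exists_isLinkage_of_finset {W A : Finset V} {B : Set V}
    (h : ∀ S : Finset V, Separates G W S A B → A.card ≤ S.card) : ∃ f, IsLinkage G W A B f := by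
  classical
  let candidates (x : ↥(W \ B : Set V)) : Finset V := (W \ A).filter fun y => y = x ∨ G.Adj x y
  have hall (s : Finset ↥(W \ B : Set V)) : s.card ≤ (s.biUnion candidates).card := by
    have hsW : ((s.map (.subtype _) : Finset V) : Set V) ⊆ W \ B := by
      simp +contextual [Set.subset_def]
    refine (s.card_map _).symm.trans_le (card_le_card_of_forall_separates hsW h ?_)
    intro x hx y hy hyA hxy
    obtain ⟨z, hz, rfl⟩ := Finset.mem_map.1 hx
    exact Finset.mem_biUnion.2 ⟨z, hz, Finset.mem_filter.2 ⟨Finset.mem_sdiff.2 ⟨hy, hyA⟩, hxy⟩⟩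
  obtain ⟨f, hf, hfc⟩ := (Finset.all_card_le_biUnion_card_iff_exists_injective candidates).1 hall
  simp only [candidates, Finset.mem_filter, Finset.mem_sdiff] at hfc
  let f' : V → V := fun x => if hx : x ∈ (W \ B : Set V) then f ⟨x, hx⟩ else x
  have hf' (x) (hx : x ∈ (W \ B : Set V)) : f' x = f ⟨x, hx⟩ := dif_pos hx
  refine ⟨f', fun x hx => ?_, fun x hx y hy hxy => ?_, fun x hx => ?_⟩
  · rw [hf' x hx]
    exact (hfc ⟨x, hx⟩).1
  · rw [hf' x hx, hf' y hy] at hxy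
    exact congrArg Subtype.val (hf hxy)
  · rw [hf' x hx]
    exact (hfc ⟨x, hx⟩).2

theorem exists_isLinkage {U B : Set V} {A : Finset V} (hAU : ↑A ⊆ U)
    (h : ∀ S : Finset V, Separates G U S A B → A.card ≤ S.card) :
    ∃ (W : Set V) (f : V → V), W.Finite ∧ ↑A ⊆ W ∧ W ⊆ U ∧ IsLinkage G W A B f := by
  classical
  obtain ⟨W, hW⟩ : ∃ W : Finset V, ∀ S : Finset V,
      Separates G (W ∩ U) S A B → A.card ≤ S.card := by
    by_contra! hno
    obtain ⟨S, hSA, hS⟩ := exists_separates_of_forall_finset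
      fun W => (hno W).imp fun S hS => hS.symm
    exact (h S hS).not_gt hSA
  let W' : Finset V := W.filter (· ∈ U) ∪ A
  have hWW' : (W ∩ U : Set V) ⊆ W' := fun v hv =>
    Finset.mem_union_left _ (Finset.mem_filter.2 hv)
  obtain ⟨f, hf⟩ := exists_isLinkage_of_finset fun S hS => hW S (hS.anti hWW')
  exact ⟨W', f, W'.finite_toSet, Finset.coe_subset.2 Finset.subset_union_right,
    fun v hv => (Finset.mem_union.1 hv).elim (fun hv => (Finset.mem_filter.1 hv).2) (@hAU v), hf⟩

namespace IsLinkage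

theorem map_mem {W A B : Set V} {f : V → V} (hf : IsLinkage G W A B f) {x : V}
    (hx : x ∈ W \ B) : f x ∈ (W \ B) \ A ∨ f x ∈ B :=
  or_iff_not_imp_right.2 fun hfB => ⟨⟨(hf.mapsTo hx).1, hfB⟩, (hf.mapsTo hx).2⟩

section Glue

variable {W C : ℕ → Set V} {f : ℕ → V → V}

theorem index_eq_of_map_eq (hf : ∀ i, IsLinkage G (W i) (C i) (C (i + 1)) (f i))
    (hW : Pairwise fun i j => Disjoint (W i \ C (i + 1)) (W j \ C (j + 1)))
    (hC : ∀ i, C i ⊆ W i \ C (i + 1)) {i j : ℕ} {x y : V} (hx : x ∈ W i \ C (i + 1))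
    (hy : y ∈ W j \ C (j + 1)) (hxy : f i x = f j y) : i = j := by
  have hy' := (hf j).map_mem hy
  rw [← hxy] at hy'
  rcases (hf i).map_mem hx with ⟨hxi, hxC⟩ | hxC <;> rcases hy' with ⟨hyj, hyC⟩ | hyC
  · exact hW.eq (Set.not_disjoint_iff.2 ⟨_, hxi, hyj⟩)
  · exact absurd hyC (hW.eq (Set.not_disjoint_iff.2 ⟨_, hxi, hC _ hyC⟩) ▸ hxC)
  · exact absurd hxC (hW.eq (Set.not_disjoint_iff.2 ⟨_, hyj, hC _ hxC⟩) ▸ hyC)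
  · exact Nat.succ_injective (hW.eq (Set.not_disjoint_iff.2 ⟨_, hC _ hxC, hC _ hyC⟩))

theorem exists_glue (hf : ∀ i, IsLinkage G (W i) (C i) (C (i + 1)) (f i))
    (hW : Pairwise fun i j => Disjoint (W i \ C (i + 1)) (W j \ C (j + 1)))
    (hC : ∀ i, C i ⊆ W i \ C (i + 1)) :
    ∃ g, IsLinkage G (⋃ i, W i \ C (i + 1)) (C 0) ∅ g := by
  choose! idx hidx using fun x (hx : x ∈ ⋃ i, W i \ C (i + 1)) => Set.mem_iUnion.1 hx
  refine ⟨fun x => f (idx x) x, ?_, ?_, ?_⟩ <;> rw [Set.sdiff_empty]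
  · intro x hx
    rcases (hf _).map_mem (hidx x hx) with ⟨hxi, hxC⟩ | hxC
    · refine ⟨Set.mem_iUnion.2 ⟨_, hxi⟩, fun hx0 => hxC ?_⟩
      exact (congrArg C (hW.eq (Set.not_disjoint_iff.2 ⟨_, hxi, hC 0 hx0⟩))).ge hx0
    · refine ⟨Set.mem_iUnion.2 ⟨_, hC _ hxC⟩, fun hx0 => ?_⟩
      exact Nat.succ_ne_zero _ (hW.eq (Set.not_disjoint_iff.2 ⟨_, hC _ hxC, hC 0 hx0⟩))
  · intro x hx y hy hxy
    have hidx_eq := index_eq_of_map_eq hf hW hC (hidx x hx) (hidx y hy) hxy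
    have hy' := hidx y hy
    simp only [← hidx_eq] at hxy hy'
    exact (hf _).injOn (hidx x hx) hy' hxy
  · exact fun x hx => (hf _).eq_or_adj x (hidx x hx)

end Glue

theorem exists_rays {W A : Set V} {f : V → V} (hf : IsLinkage G W A ∅ f) (hA : A ⊆ W) :
    ∃ ρ : A → Ray G, (∀ a, (ρ a).verts ⊆ W) ∧
      Pairwise fun a b => Disjoint (ρ a).verts (ρ b).verts := by
  obtain ⟨hmaps, hinj, hadj⟩ := hf
  rw [Set.sdiff_empty] at hmaps hinj hadj
  have iterate_mem (a : A) (n : ℕ) : f^[n] a ∈ W :=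
    (hmaps.mono_right Set.sdiff_subset).iterate n (hA a.2)
  have iterate_succ_ne (a b : A) (n : ℕ) : f^[n + 1] a ≠ b := by
    rw [Function.iterate_succ_apply']
    exact fun h => (hmaps (iterate_mem a n)).2 (h ▸ b.2)
  have iterate_inj {a b : A} {m n : ℕ} (h : f^[m] a = f^[n] b) : a = b ∧ m = n := by
    induction m generalizing n with
    | zero =>
      cases n with
      | zero => exact ⟨Subtype.ext h, rfl⟩
      | succ n => exact absurd h.symm (iterate_succ_ne b a n)
    | succ m ih =>
      cases n with
      | zero => exact absurd h (iterate_succ_ne a b m)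
      | succ n =>
        rw [Function.iterate_succ_apply', Function.iterate_succ_apply'] at h
        exact (ih (hinj (iterate_mem a m) (iterate_mem b n) h)).imp_right (congrArg _)
  refine ⟨fun a => ⟨fun n => f^[n] a, fun m n h => (iterate_inj h).2, fun n => ?_⟩, ?_, ?_⟩
  · rw [Function.iterate_succ_apply']
    refine (hadj _ (iterate_mem a n)).resolve_left fun h => ?_
    rw [← Function.iterate_succ_apply' f] at h
    exact absurd (iterate_inj h).2 n.succ_ne_self
  · rintro a _ ⟨n, rfl⟩
    exact iterate_mem a n
  · refine fun a b hab => Set.disjoint_left.2 ?_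
    rintro _ ⟨m, rfl⟩ ⟨n, hn⟩
    exact hab (iterate_inj hn).1.symm

end IsLinkage

/-! ### Tight separations -/

namespace GraphEnd

variable {ω : GraphEnd G} {s t : FinSep G}

theorem card_le_degree {ι : Type*} {ρ : ι → Ray G} (hρ : ∀ i, ρ i ∈ ω.rays)
    (hdisj : Pairwise fun i j => Disjoint (ρ i).verts (ρ j).verts) : ENat.card ι ≤ ω.degree := by
  have hinj : ρ.Injective := fun i j hij => by_contra fun hne =>
    Set.disjoint_left.1 (hdisj hne) ⟨0, rfl⟩ (hij ▸ ⟨0, rfl⟩)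
  refine hinj.encard_range.trans (le_iSup₂_of_le _ ⟨Set.range_subset_iff.2 hρ, ?_⟩ le_rfl)
  rintro _ ⟨i, rfl⟩ _ ⟨j, rfl⟩ hne
  exact hdisj (ne_of_apply_ne ρ hne)

/-- The set of vertices that dominate `ω`; its size is `ω.dom`. -/
def dominators (ω : GraphEnd G) : Set V := {v | ω.IsDominatedBy v}

/-- The vertices of the separator `A ∩ B` that do not dominate `ω`. These are the vertices in which
disjoint rays of `ω` are going to start. -/
def core (ω : GraphEnd G) (s : FinSep G) : Set V := (s.1.A ∩ s.1.B) \ ω.dominators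

theorem core_finite (ω : GraphEnd G) (s : FinSep G) : (ω.core s).Finite :=
  s.2.sdiff

theorem dominators_subset_inter (hs : s ∈ ω.tangle) (hD : ω.dominators ⊆ s.1.A) :
    ω.dominators ⊆ s.1.A ∩ s.1.B := fun _ hv => ⟨hD hv, mem_B_of_isDominatedBy hv hs⟩

theorem encard_core_add_dom (hs : s ∈ ω.tangle) (hD : ω.dominators ⊆ s.1.A) :
    (ω.core s).encard + ω.dom = s.1.order :=
  Set.encard_sdiff_add_encard_of_subset (dominators_subset_inter hs hD)

theorem exists_mem_tangle_separating (ω : GraphEnd G) {Z : Set V} (hZ : Z.Finite) :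
    ∃ s ∈ ω.tangle, Z ⊆ s.1.A ∧ Z ∩ s.1.B ⊆ ω.dominators := by
  induction Z, hZ using Set.Finite.induction_on with
  | empty => exact ⟨_, sepAt_mem_tangle Set.finite_empty, by simp⟩
  | @insert z Z _ _ ih =>
    obtain ⟨s, hs, hZA, hZB⟩ := ih
    obtain ⟨t, ht, hzA, hzB⟩ : ∃ t ∈ ω.tangle, z ∈ t.1.A ∧ (z ∈ t.1.B → z ∈ ω.dominators) := by
      by_cases hz : ω.IsDominatedBy z
      · refine ⟨ω.sepAt (Set.finite_singleton z), sepAt_mem_tangle _, ?_, fun _ => hz⟩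
        exact ((sepAt_inter (Set.finite_singleton z)).ge rfl).1
      · obtain ⟨t, ht, hzt⟩ := exists_mem_tangle_notMem_B hz
        exact ⟨t, ht, (t.1.mem_or z).resolve_right hzt, fun h => absurd h hzt⟩
    refine ⟨s ⊔ t, sup_mem_tangle hs ht, ?_, ?_⟩
    · rintro x (rfl | hx)
      · exact Or.inr hzA
      · exact Or.inl (hZA hx)
    · rintro x ⟨rfl | hx, hxB⟩
      · exact hzB hxB.2
      · exact hZB ⟨hx, hxB.1⟩

theorem subset_component_of_preconnected {M S : Set V} (hS : S.Finite)
    (hM : (G.induce M).Preconnected) (hMS : Disjoint M S) {R : Ray G} (hR : R ∈ ω.rays)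
    (hRM : R.HasTailIn M) : M ⊆ ω.component hS := by
  obtain ⟨w, -, hwM, hwC⟩ := (hRM.inter (hasTailIn_component hR hS)).exists_mem
  exact fun v hv => mem_componentCompl_of_joined hwC
    ((preconnected_induce_iff_joined.1 hM w hwM v hv).mono hMS.subset_compl_right)

/-- A separation in the end tangle of `ω` is tight if its side `B \ A` is connected and no larger
separation in the tangle has smaller order. -/
structure IsTight (ω : GraphEnd G) (s : FinSep G) : Prop where
  mem_tangle : s ∈ ω.tangle
  preconnected : (G.induce (s.1.B \ s.1.A)).Preconnected
  order_le : ∀ t ∈ ω.tangle, s ≤ t → s.1.order ≤ t.1.order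

theorem exists_isTight_ge (hs : s ∈ ω.tangle) : ∃ t, ω.IsTight t ∧ s ≤ t := by
  obtain ⟨u, ⟨hu, hsu⟩, hmin⟩ := exists_minimalFor_of_wellFoundedLT
    (fun u => u ∈ ω.tangle ∧ s ≤ u) (fun u => u.1.order) ⟨s, hs, le_rfl⟩
  have hut := le_sepAt hu
  refine ⟨ω.sepAt u.2, ⟨sepAt_mem_tangle _, ?_, fun t ht hle => ?_⟩, hsu.trans hut⟩
  · rw [sepAt_diff]
    exact preconnected_induce_componentCompl _
  · have horder : (ω.sepAt u.2).1.order = u.1.order := congrArg Set.encard (sepAt_inter u.2)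
    rw [horder]
    exact (le_total _ _).elim id (hmin ⟨ht, hsu.trans (hut.trans hle)⟩)

theorem disjoint_core_component_of_separates (ht : t ∈ ω.tangle) (hst : s ≤ t) {S : Set V}
    (hS : (S ∪ ω.dominators).Finite)
    (hsep : Separates G ((s.1.B ∩ t.1.A) \ ω.dominators) S (ω.core s) (ω.core t)) :
    Disjoint (ω.core s) (ω.component hS) := by
  refine Set.disjoint_left.2 fun a ha haC => ?_
  obtain ⟨R, hR⟩ := ω.exists_mem_rays
  obtain ⟨v, -, hvC, hvt⟩ := ((hasTailIn_component hR hS).inter (ht R hR)).exists_mem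
  have hav : Joined G (S ∪ ω.dominators)ᶜ a v :=
    (preconnected_induce_iff_joined.1 (preconnected_induce_componentCompl _) a haC v hvC).mono
      (ω.component hS).disjoint_right.subset_compl_left
  obtain ⟨b, hb, hvb⟩ := s.1.swap.exists_mem_inter_of_joined hav.symm (hst.2 hvt) ha.1.1
  obtain ⟨c, hc, hbc⟩ := t.1.exists_mem_inter_of_joined hvb.symm (hst.1 hb.2) hvt
  have mem_core {u : FinSep G} {x : V} (hx : x ∈ u.1.A ∩ u.1.B)
      (hxS : x ∈ (S ∪ ω.dominators)ᶜ) : x ∈ ω.core u := ⟨hx, fun h => hxS (Or.inr h)⟩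
  refine hsep b (mem_core hb.symm hvb.right_mem.1) c (mem_core hc hbc.right_mem.1.1) (hbc.mono ?_)
  rintro x ⟨⟨hx, hxs⟩, hxt⟩
  exact ⟨⟨⟨hxs, hxt⟩, fun h => hx (Or.inr h)⟩, fun h => hx (Or.inl h)⟩

namespace IsTight

/-- Otherwise `s ⊔ ω.sepAt (S ∪ ω.dominators)` would be a larger separation of smaller order. -/
theorem encard_core_le_of_separates (hs : ω.IsTight s) (ht : t ∈ ω.tangle) (hst : s ≤ t)
    (hD : ω.dominators ⊆ s.1.A) {S : Set V} (hS : S.Finite)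
    (hsep : Separates G ((s.1.B ∩ t.1.A) \ ω.dominators) S (ω.core s) (ω.core t)) :
    (ω.core s).encard ≤ S.encard := by
  have hDfin : ω.dominators.Finite := s.2.subset (dominators_subset_inter hs.mem_tangle hD)
  have hSD := hS.union hDfin
  have hdisj := disjoint_core_component_of_separates ht hst hSD hsep
  let u := s ⊔ ω.sepAt hSD
  have hu : u.1.A ∩ u.1.B ⊆ S ∪ ω.dominators := by
    rintro v ⟨hvA, hvs, hv⟩
    refine hv.resolve_left fun hvC => Set.disjoint_left.1 hdisj ⟨⟨?_, hvs⟩, fun hvD => ?_⟩ hvC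
    · exact hvA.resolve_right fun h => h hvC
    · exact SimpleGraph.ComponentCompl.notMem_of_mem hvC (Or.inr hvD)
  refine (ENat.add_le_add_iff_right hDfin.encard_lt_top.ne).1 ?_
  calc (ω.core s).encard + ω.dom
    _ = s.1.order := encard_core_add_dom hs.mem_tangle hD
    _ ≤ u.1.order := hs.order_le _ (sup_mem_tangle hs.mem_tangle (sepAt_mem_tangle _)) le_sup_left
    _ ≤ (S ∪ ω.dominators).encard := Set.encard_le_encard hu
    _ ≤ S.encard + ω.dom := Set.encard_union_le _ _

theorem exists_isLinkage (hs : ω.IsTight s) (ht : t ∈ ω.tangle) (hst : s ≤ t)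
    (hD : ω.dominators ⊆ s.1.A) :
    ∃ (W : Set V) (f : V → V), W.Finite ∧ ω.core s ⊆ W ∧
      W ⊆ (s.1.B ∩ t.1.A) \ ω.dominators ∧ IsLinkage G W (ω.core s) (ω.core t) f := by
  obtain ⟨C, hC⟩ := (ω.core_finite s).exists_finset_coe
  rw [← hC]
  refine EndTangle.exists_isLinkage ?_ fun S hS => ?_
  · rw [hC]
    exact fun v hv => ⟨⟨hv.1.2, hst.1 hv.1.1⟩, hv.2⟩
  · rw [hC] at hS
    have := hs.encard_core_le_of_separates ht hst hD S.finite_toSet hS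
    rwa [← hC, Set.encard_coe_eq_coe_finsetCard, Set.encard_coe_eq_coe_finsetCard,
      Nat.cast_le] at this

end IsTight

end GraphEnd

/-! ### Chains of tight separations -/

namespace GraphEnd

variable {ω : GraphEnd G} {s t : FinSep G} {c : ℕ → FinSep G}

theorem IsTight.encard_core_le (hs : ω.IsTight s) (ht : t ∈ ω.tangle) (hst : s ≤ t)
    (hD : ω.dominators ⊆ s.1.A) : (ω.core s).encard ≤ (ω.core t).encard := by
  have hDfin : ω.dominators.Finite := s.2.subset (dominators_subset_inter hs.mem_tangle hD)
  refine (ENat.add_le_add_iff_right hDfin.encard_lt_top.ne).1 ?_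
  exact (encard_core_add_dom hs.mem_tangle hD).trans_le <|
    (hs.order_le t ht hst).trans_eq (encard_core_add_dom ht (hD.trans hst.1)).symm

/-- An increasing sequence of tight separations that leave the core of each of them behind in the
next step. All vertices that do not dominate `ω` will be left behind eventually. -/
structure IsTightChain (ω : GraphEnd G) (c : ℕ → FinSep G) : Prop where
  isTight : ∀ i, ω.IsTight (c i)
  monotone : Monotone c
  dominators_subset : ω.dominators ⊆ (c 0).1.A
  disjoint_core_succ : ∀ i, Disjoint (ω.core (c i)) (c (i + 1)).1.B

theorem exists_isTightChain (hs : s ∈ ω.tangle) (hD : ω.dominators ⊆ s.1.A) :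
    ∃ c, ω.IsTightChain c ∧ s ≤ c 0 := by
  have exists_next (t : FinSep G) (ht : t ∈ ω.tangle) :
      ∃ u, ω.IsTight u ∧ t ≤ u ∧ Disjoint (ω.core t) u.1.B := by
    obtain ⟨r, hr, -, hrB⟩ := ω.exists_mem_tangle_separating (ω.core_finite t)
    obtain ⟨u, hu, htu⟩ := exists_isTight_ge (sup_mem_tangle ht hr)
    exact ⟨u, hu, le_sup_left.trans htu, Set.disjoint_left.2 fun v hv hvu =>
      hv.2 (hrB ⟨hv, (htu.2 hvu).2⟩)⟩
  have : Nonempty (FinSep G) := ⟨s⟩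
  choose! next tight le disj using exists_next
  have mem_tangle (n : ℕ) : next^[n] s ∈ ω.tangle := by
    induction n with
    | zero => exact hs
    | succ n ih =>
      rw [Function.iterate_succ_apply']
      exact (tight _ ih).mem_tangle
  refine ⟨fun n => next^[n + 1] s, ⟨fun i => ?_, monotone_nat_of_le_succ fun i => ?_,
    hD.trans (le s hs).1, fun i => ?_⟩, le s hs⟩
  · rw [Function.iterate_succ_apply']
    exact tight _ (mem_tangle i)
  · rw [Function.iterate_succ_apply' next (i + 1)]
    exact le _ (mem_tangle (i + 1))
  · rw [Function.iterate_succ_apply' next (i + 1)]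
    exact disj _ (mem_tangle (i + 1))

namespace IsTightChain

theorem mem_tangle (hc : ω.IsTightChain c) (i : ℕ) : c i ∈ ω.tangle :=
  (hc.isTight i).mem_tangle

theorem dominators_subset_A (hc : ω.IsTightChain c) (i : ℕ) : ω.dominators ⊆ (c i).1.A :=
  hc.dominators_subset.trans (hc.monotone i.zero_le).1

theorem disjoint_core (hc : ω.IsTightChain c) {i j : ℕ} (hij : i < j) :
    Disjoint (ω.core (c i)) (c j).1.B :=
  (hc.disjoint_core_succ i).mono_right (hc.monotone hij).2

/-- A vertex in all sides `B` is joined to the core of `c 1` by a finite path that avoids all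
dominating vertices, but this path would have to meet the disjoint cores of all later `c i`. -/
theorem exists_notMem_B (hc : ω.IsTightChain c) (hne : (ω.core (c 1)).Nonempty) {v : V}
    (hv : v ∉ ω.dominators) : ∃ i, v ∉ (c i).1.B := by
  by_contra! hvB
  have mem_diff {x : V} (hx : x ∈ (c 1).1.B) (hxD : x ∉ ω.dominators) :
      x ∈ (c 0).1.B \ (c 0).1.A := by
    have hx0 := (hc.monotone zero_le_one).2 hx
    exact ⟨hx0, fun hxA => Set.disjoint_left.1 (hc.disjoint_core zero_lt_one) ⟨⟨hxA, hx0⟩, hxD⟩ hx⟩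
  obtain ⟨y, hy⟩ := hne
  obtain ⟨F, hF, hyv⟩ := (preconnected_induce_iff_joined.1 (hc.isTight 0).preconnected
    y (mem_diff hy.1.2 hy.2) v (mem_diff (hvB 1) hv)).exists_finset
  have meets_core (i : ℕ) : ∃ w ∈ F, w ∈ ω.core (c (i + 1)) := by
    obtain ⟨w, hw, hyw⟩ := (c (i + 1)).1.exists_mem_inter_of_joined hyv
      ((hc.monotone (Nat.le_add_left 1 i)).1 hy.1.1) (hvB _)
    exact ⟨w, hyw.right_mem.1, hw, fun h => (hF hyw.right_mem.1).2 (hc.dominators_subset h)⟩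
  choose w hwF hw using meets_core
  have hinj : w.Injective := by
    refine .of_lt_imp_ne fun i j hij h => ?_
    exact Set.disjoint_left.1 (hc.disjoint_core (Nat.succ_lt_succ hij)) (hw i) (h ▸ (hw j).1.2)
  exact Set.infinite_range_of_injective hinj
    (F.finite_toSet.subset (Set.range_subset_iff.2 hwF))

theorem exists_inter_B_subset (hc : ω.IsTightChain c) (hne : (ω.core (c 1)).Nonempty) {S : Set V}
    (hS : S.Finite) : ∃ i, S ∩ (c i).1.B ⊆ ω.dominators := by
  have eventually_mem (v : V) : ∀ᶠ i in Filter.atTop, v ∈ (c i).1.B → v ∈ ω.dominators := by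
    by_cases hv : v ∈ ω.dominators
    · exact .of_forall fun _ _ => hv
    · obtain ⟨i, hi⟩ := hc.exists_notMem_B hne hv
      filter_upwards [Filter.eventually_ge_atTop i] with j hij hvj
      exact absurd ((hc.monotone hij).2 hvj) hi
  obtain ⟨i, hi⟩ := ((Filter.eventually_all_finite hS).2 fun v _ => eventually_mem v).exists
  exact ⟨i, fun v hv => hi v hv.1 hv.2⟩

theorem mem_rays_of_hasTailIn (hc : ω.IsTightChain c) (hne : (ω.core (c 1)).Nonempty)
    {R : Ray G} (hR : ∀ i, R.HasTailIn ((c i).1.B \ (c i).1.A)) : R ∈ ω.rays := by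
  refine mem_rays_iff.2 fun S hS => ?_
  obtain ⟨i, hi⟩ := hc.exists_inter_B_subset hne hS
  obtain ⟨R', hR'⟩ := ω.exists_mem_rays
  refine (hR i).mono (subset_component_of_preconnected hS (hc.isTight i).preconnected ?_ hR'
    (hasTailIn_diff (hc.mem_tangle i) hR'))
  exact Set.disjoint_left.2 fun v hv hvS => hv.2 (hc.dominators_subset_A i (hi ⟨hvS, hv.1⟩))

theorem hasTailIn_diff_of_verts_subset (hc : ω.IsTightChain c) {W : ℕ → Set V}
    (hWfin : ∀ i, (W i).Finite) (hW : ∀ i, W i ⊆ ((c i).1.B ∩ (c (i + 1)).1.A) \ ω.dominators)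
    {R : Ray G} (hR : R.verts ⊆ ⋃ i, W i) (i : ℕ) : R.HasTailIn ((c i).1.B \ (c i).1.A) := by
  obtain ⟨n, hn⟩ := R.hasTailIn_compl ((Set.finite_Iic i).biUnion fun j _ => hWfin j)
  refine ⟨n, fun m hm => ?_⟩
  obtain ⟨j, hj⟩ := Set.mem_iUnion.1 (hR ⟨m, rfl⟩)
  have hij : i < j := by
    by_contra! hji
    exact hn m hm (Set.mem_biUnion hji hj)
  obtain ⟨⟨hmB, -⟩, hmD⟩ := hW j hj
  have hmBi := (hc.monotone hij.le).2 hmB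
  exact ⟨hmBi, fun hmA => Set.disjoint_left.1 (hc.disjoint_core hij) ⟨⟨hmA, hmBi⟩, hmD⟩ hmB⟩

/-- Concatenating the linkages between consecutive cores yields disjoint rays of `ω`. -/
theorem encard_core_le_degree (hc : ω.IsTightChain c) : (ω.core (c 0)).encard ≤ ω.degree := by
  obtain hempty | hne := (ω.core (c 0)).eq_empty_or_nonempty
  · simp [hempty]
  have hne1 : (ω.core (c 1)).Nonempty := Set.encard_pos.1 <| (Set.encard_pos.2 hne).trans_le <|
    (hc.isTight 0).encard_core_le (hc.mem_tangle 1) (hc.monotone zero_le_one) hc.dominators_subset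
  choose W f hWfin hcoreW hWU hf using fun i => (hc.isTight i).exists_isLinkage
    (hc.mem_tangle (i + 1)) (hc.monotone i.le_succ) (hc.dominators_subset_A i)
  have notMem_B {i : ℕ} {v : V} (hv : v ∈ W i \ ω.core (c (i + 1))) : v ∉ (c (i + 1)).1.B :=
    fun hvB => hv.2 ⟨⟨(hWU i hv.1).1.2, hvB⟩, (hWU i hv.1).2⟩
  have hdisj : Pairwise fun i j =>
      Disjoint (W i \ ω.core (c (i + 1))) (W j \ ω.core (c (j + 1))) := by
    refine (pairwise_disjoint_on _).2 fun i j hij => Set.disjoint_left.2 fun v hvi hvj => ?_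
    exact notMem_B hvi ((hc.monotone hij).2 (hWU j hvj.1).1.1)
  have hcore (i : ℕ) : ω.core (c i) ⊆ W i \ ω.core (c (i + 1)) := fun v hv =>
    ⟨hcoreW i hv, fun hv' => Set.disjoint_left.1 (hc.disjoint_core i.lt_succ_self) hv hv'.1.2⟩
  obtain ⟨g, hg⟩ := IsLinkage.exists_glue hf hdisj hcore
  obtain ⟨ρ, hρ, hρdisj⟩ := hg.exists_rays fun v hv => Set.mem_iUnion.2 ⟨0, hcore 0 hv⟩
  refine card_le_degree (fun a => hc.mem_rays_of_hasTailIn hne1 fun i =>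
    hc.hasTailIn_diff_of_verts_subset hWfin hWU ((hρ a).trans ?_) i) hρdisj
  exact Set.iUnion_mono fun i => Set.sdiff_subset

end IsTightChain

end GraphEnd

namespace GraphEnd

theorem exists_mem_tangle_order_le (ω : GraphEnd G) (hD : ω.dominators.Finite) {Z : Set V}
    (hZ : Z.Finite) : ∃ s ∈ ω.tangle, s.1.order ≤ ω.degree + ω.dom ∧
      Z ⊆ s.1.A ∧ Z ∩ s.1.B ⊆ ω.dominators := by
  obtain ⟨s, hs, hsA, hsB⟩ := ω.exists_mem_tangle_separating (hZ.union hD)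
  obtain ⟨hZA, hDA⟩ := Set.union_subset_iff.1 hsA
  obtain ⟨c, hc, hsc⟩ := exists_isTightChain hs hDA
  refine ⟨c 0, hc.mem_tangle 0, ?_, hZA.trans hsc.1, fun v hv =>
    hsB ⟨Or.inl hv.1, hsc.2 hv.2⟩⟩
  rw [← encard_core_add_dom (hc.mem_tangle 0) hc.dominators_subset]
  gcongr
  exact hc.encard_core_le_degree

/-- The separation `(V, D)`, where `D` is the set of vertices that dominate `ω`, is not in the end
tangle, but it is a limit of separations in it. -/
theorem le_degree_add_dom_of_isClosed (ω : GraphEnd G) {k : ℕ}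
    (hclosed : IsClosed (ω.tangle ∩ sepsBelow G k)) : (k : ℕ∞) ≤ ω.degree + ω.dom := by
  by_contra! hk
  have hD : ω.dominators.Finite :=
    Set.finite_of_encard_le_coe (le_add_self.trans hk.le)
  let p : FinSep G :=
    ⟨{ A := Set.univ
       B := ω.dominators
       union_eq := Set.univ_union _
       not_adj := fun _ _ _ hb => absurd (Set.mem_univ _) hb.2 }, hD.subset Set.inter_subset_right⟩
  have hp : p ∈ closure (ω.tangle ∩ sepsBelow G k) := by
    refine (mem_closure_iff_nhds_basis p.nhds_hasBasis).2 fun Z hZ => ?_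
    obtain ⟨s, hs, hsk, hZA, hZB⟩ := ω.exists_mem_tangle_order_le hD hZ
    refine ⟨s, ⟨hs, hsk.trans_lt hk⟩, FinSep.mem_basicOpen_restrict_iff.2 ⟨?_, ?_⟩⟩
    · rw [Set.univ_inter, Set.inter_eq_right.2 hZA]
    · refine Set.Subset.antisymm (fun v hv => ⟨hZB hv.symm, hv.2⟩) fun v hv => ⟨?_, hv.2⟩
      exact mem_B_of_isDominatedBy hv.1 hs
  obtain ⟨R, hR⟩ := ω.exists_mem_rays
  have hRD : R.HasTailIn ω.dominators := (hclosed.closure_subset hp).1 R hR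
  obtain ⟨v, -, hvD, hvD'⟩ := (hRD.inter (R.hasTailIn_compl hD)).exists_mem
  exact hvD' hvD

end GraphEnd

end EndTangle

theorem mainTheorem1 {V : Type*} (G : SimpleGraph V) (ω : EndTangle.GraphEnd G) (k : ℕ) :
    List.TFAE [
      IsClosed (ω.tangle ∩ EndTangle.sepsBelow G k),
      (k : ℕ∞) ≤ ω.degree + ω.dom,
      ∃ X : Set V, X.Finite ∧
        EndTangle.IsRelativeDecider X (ω.tangle ∩ EndTangle.sepsBelow G k),
      ∃ X : Set V, X.encard = k ∧
        EndTangle.IsRelativeDecider X (ω.tangle ∩ EndTangle.sepsBelow G k)] := by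
  tfae_have 1 → 2 := ω.le_degree_add_dom_of_isClosed
  tfae_have 2 → 4 := ω.exists_isRelativeDecider_of_le
  tfae_have 4 → 3 := fun ⟨X, hX, hdec⟩ => ⟨X, Set.finite_of_encard_eq_coe hX, hdec⟩
  tfae_have 3 → 1 := fun ⟨_, hX, hdec⟩ => ω.isClosed_of_isRelativeDecider hX hdec
  tfae_finish
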